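/- \textbf{Definitions.} An \emph{oriented matroid} is a triple $(E,*,cx)$, where $E$ is a set, $*$ is an involution of $E$ without fixed points, and $cx$ is a closure operator on the subsets of $E$ such that for all $X\subseteq E$ and $x,y\in E$: (i) if $x\in cx(X)$ then $x\in cx(Y)$ for some finite $Y\subseteq X$; (ii) $cx(X)^*=cx(X^*)$; (iii) if $x\in cx(X\cup\{x^*\})$ then $x\in cx(X)$; (iv) if $x\in cx(X\cup\{y^*\})$ and $x\notin cx(X)$ then $y\in cx((X\setminus\{y\})\cup\{x^*\})$. A subset of a real vector space is \emph{positively independent} if no nonempty finite linear combination of distinct elements of it with strictly positive coefficients is zero. A \emph{realized root system datum} consists of real vector spaces $V,V^\vee$, a bilinear pairing $(-,-):V\times V^\vee\to\mathbb R$, positively independent subsets $\Pi\subseteq V$ and $\Pi^\vee\subseteq V^\vee$, and a bijection $\Pi\to\Pi^\vee$, $\alpha\mapsto\alpha^\vee$, such that $(\alpha,\alpha^\vee)=2$ for all $\alpha\in\Pi$ and, for all $\alpha\ne\beta$ in $\Pi$: $(\alpha,\beta^\vee)\le 0$; $(\alpha,\beta^\vee)=0$ if and only if $(\beta,\alpha^\vee)=0$;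 and $(\alpha,\beta^\vee)(\beta,\alpha^\vee)\in\{4\cos^2\frac{\pi}{m}: m\in\mathbb N,\ m\ge 2\}\cup[4,\infty)$. Put $s_\alpha(v)=v-(v,\alpha^\vee)\alpha$ for $\alpha\in\Pi$, $\widehat S=\{s_\alpha:\alpha\in\Pi\}$, and let $\widehat W\subseteq GL(V)$ be the subgroup generated by $\widehat S$. A \emph{realized root system datum of a Coxeter system} $(W,S)$ is such a datum together with a group isomorphism $W\to\widehat W$ carrying $S$ bijectively onto $\widehat S$; through it $W$ acts on $V$ and is identified with $\widehat W$. Its (realized) root system is $\Phi=W\Pi$. For a set $\Gamma\subseteq V$ let $\operatorname{cone}(\Gamma)$ be the set of finite nonnegative linear combinations of elements of $\Gamma$ (including $0$), and put $\Phi^+=\Phi\cap\operatorname{cone}(\Pi)$ and $\operatorname{cone}_\Phi(\Gamma)=\operatorname{cone}(\Gamma)\cap\Phi$ for $\Gamma\subseteq\Phi$. Let $T$ be the set of reflections of $(W,S)$, i.e. of conjugates of elements of $S$. Let $\pi:\Phi\to T\times\{\pm1\}$ be given by $\epsilon\alpha\mapsto(s_\alpha,\epsilon)$ for $\alpha\in\Phi^+$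 and $\epsilon\in\{\pm1\}$, where $s_\alpha=wsw^{-1}$ if $\alpha=w(\beta)$ with $w\in W$ and $\beta\in\Pi$ the simple root with $s_\beta=s$. For $A\subseteq T\times\{\pm1\}$ put $c_\Phi(A)=\pi(\operatorname{cone}_\Phi(\pi^{-1}(A)))$. The \emph{oriented matroid structure on $T\times\{\pm1\}$ given by $\Phi$} is $(T\times\{\pm1\},*,c_\Phi)$ with $(t,\epsilon)^*=(t,-\epsilon)$. An \emph{irreducible affine Weyl group} is a Coxeter system isomorphic to the affine Weyl group of an irreducible reduced crystallographic root system (the group generated by the reflections in all affine hyperplanes $\langle\alpha,x\rangle=k$, with $\alpha$ a root and $k\in\mathbb Z$), with its canonical generators: the reflections in the hyperplanes $\langle\alpha,x\rangle=0$ for $\alpha$ a simple root, and the reflection in $\langle\theta,x\rangle=1$ for $\theta$ the highest root. It is of type $\widetilde A_n$ ($n\ge 1$) if its Coxeter graph is an unlabelled cycle with $n+1$ vertices ($n\ge2$), or a single edge labelled $\infty$ ($n=1$). \textbf{Corollary.} Let $(W,S)$ be a Coxeter system such that either $W$ is finite, or $(W,S)$ is an irreducible affine Weyl group which is not of type $\widetilde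 A_n$ for any $n\ge 1$. Then all realized root systems of $(W,S)$ give the same oriented matroid structure on $T\times\{\pm1\}$: for any two realized root system data of $(W,S)$, with root systems $\Phi$ and $\Phi'$, one has $c_\Phi=c_{\Phi'}$, and $(T\times\{\pm1\},*,c_\Phi)$ is an oriented matroid. -/

import Mathlib

/-! ### Oriented matroids -/

/-- An oriented matroid `(E, *, cx)`: a set with a fixed-point-free involution and a closure
operator on its subsets satisfying the four axioms below. -/
structure OrientedMatroid (E : Type*) where
  /-- the involution `x ↦ x*` -/
  inv : E → E
  inv_inv : ∀ x, inv (inv x) = x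
  inv_ne : ∀ x, inv x ≠ x
  /-- the closure operator `cx` -/
  cl : ClosureOperator (Set E)
  finitary : ∀ (X : Set E) (x : E), x ∈ cl X → ∃ Y : Set E, Y ⊆ X ∧ Y.Finite ∧ x ∈ cl Y
  inv_cl : ∀ X : Set E, inv '' cl X = cl (inv '' X)
  mem_of_mem_insert_inv : ∀ (X : Set E) (x : E), x ∈ cl (X ∪ {inv x}) → x ∈ cl X
  exchange : ∀ (X : Set E) (x y : E), x ∈ cl (X ∪ {inv y}) → x ∉ cl X →
    y ∈ cl ((X \ {y}) ∪ {inv x})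

/-! ### Realized root systems -/

/-- No nonempty finite combination of the family with strictly positive coefficients vanishes. -/
def PositivelyIndependent {ι V : Type*} [AddCommGroup V] [Module ℝ V] (v : ι → V) : Prop :=
  ∀ (s : Finset ι) (c : ι → ℝ), s.Nonempty → (∀ i ∈ s, 0 < c i) → ∑ i ∈ s, c i • v i ≠ 0

/-- A realized root system datum `(V, V^∨, (-,-), Π, Π^∨, ι)`. The sets `Π` and `Π^∨` of simple
roots and coroots are indexed by `B`, and `ι` sends `root i` to `coroot i`. Both families are
automatically injective, by `pairing_self` and `pairing_nonpos`. -/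
structure RealizedRootDatum (B V Vd : Type*) [AddCommGroup V] [Module ℝ V]
    [AddCommGroup Vd] [Module ℝ Vd] where
  /-- the bilinear pairing `(-,-)` -/
  pairing : V →ₗ[ℝ] Vd →ₗ[ℝ] ℝ
  /-- the simple roots -/
  root : B → V
  /-- the simple coroots -/
  coroot : B → Vd
  root_posIndep : PositivelyIndependent root
  coroot_posIndep : PositivelyIndependent coroot
  pairing_self : ∀ i, pairing (root i) (coroot i) = 2
  pairing_nonpos : ∀ i j, i ≠ j → pairing (root i) (coroot j) ≤ 0
  pairing_eq_zero_iff : ∀ i j, i ≠ j →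
    (pairing (root i) (coroot j) = 0 ↔ pairing (root j) (coroot i) = 0)
  pairing_mul_pairing : ∀ i j, i ≠ j →
    (∃ m : ℕ, 2 ≤ m ∧ pairing (root i) (coroot j) * pairing (root j) (coroot i) =
        4 * Real.cos (Real.pi / m) ^ 2) ∨
      4 ≤ pairing (root i) (coroot j) * pairing (root j) (coroot i)

namespace RealizedRootDatum

variable {B V Vd : Type*} [AddCommGroup V] [Module ℝ V] [AddCommGroup Vd] [Module ℝ Vd]

/-- The simple reflection `v ↦ v - (v, α_i^∨) α_i` of `V`. -/
def simpleReflection (D : RealizedRootDatum B V Vd) (i : B) : V ≃ₗ[ℝ] V :=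
  Module.reflection (x := D.root i) (f := D.pairing.flip (D.coroot i)) (D.pairing_self i)

/-- The subgroup of `GL(V)` generated by the simple reflections. -/
def reflectionGroup (D : RealizedRootDatum B V Vd) : Subgroup (V ≃ₗ[ℝ] V) :=
  Subgroup.closure (Set.range D.simpleReflection)

end RealizedRootDatum

namespace CoxeterSystem

variable {B W : Type*} [Group W] {M : CoxeterMatrix B}

/-- The set `T` of reflections of `(W, S)`. -/
abbrev Reflections (cs : CoxeterSystem M W) : Type _ := {t : W // cs.IsReflection t}

/-- A realized root system datum of the Coxeter system `(W, S)`: a realized root system datum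
with an isomorphism from `(W, S)` to the group generated by its simple reflections, together with
its set of simple reflections. The simple roots are indexed so that `simple i` corresponds to the
reflection in `root i`. -/
structure Realization (cs : CoxeterSystem M W) (V Vd : Type*) [AddCommGroup V] [Module ℝ V]
    [AddCommGroup Vd] [Module ℝ Vd] extends RealizedRootDatum B V Vd where
  /-- the isomorphism of Coxeter systems -/
  equiv : W ≃* toRealizedRootDatum.reflectionGroup
  equiv_simple : ∀ i, (equiv (cs.simple i) : V ≃ₗ[ℝ] V) = toRealizedRootDatum.simpleReflection i

namespace Realization

variable {cs : CoxeterSystem M W} {V Vd : Type*} [AddCommGroup V] [Module ℝ V]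
  [AddCommGroup Vd] [Module ℝ Vd]

/-- The root `w(α_i)`. -/
def rootAt (D : cs.Realization V Vd) (w : W) (i : B) : V := (D.equiv w : V ≃ₗ[ℝ] V) (D.root i)

/-- The root system `Φ`, the set of all `w(α_i)`. -/
def roots (D : cs.Realization V Vd) : Set V := {β | ∃ w i, β = D.rootAt w i}

/-- The positive roots `Φ⁺`, the intersection of `Φ` with the cone of the simple roots. -/
def posRoots (D : cs.Realization V Vd) : Set V :=
  D.roots ∩ (PointedCone.hull ℝ (Set.range D.root) : PointedCone ℝ V)

/-- The graph of the canonical surjection `π : Φ → T × {±1}`, which sends `ε α` to `(s_α, ε)` for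
`α` a positive root and `ε = ±1`. Here the reflection in `α = w(α_i)` is `w s_i w⁻¹`. -/
def Proj (D : cs.Realization V Vd) (β : V) (x : cs.Reflections × ℤˣ) : Prop :=
  ∃ (w : W) (i : B), D.rootAt w i ∈ D.posRoots ∧
    (x.1 : W) = w * cs.simple i * w⁻¹ ∧ β = (x.2 : ℤ) • D.rootAt w i

/-- The closure operator `cone_Φ(Γ) = cone(Γ) ∩ Φ`. -/
def coneClosure (D : cs.Realization V Vd) (Γ : Set V) : Set V :=
  (PointedCone.hull ℝ Γ : PointedCone ℝ V) ∩ D.roots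

/-- The preimage `π⁻¹(A)`. -/
def preimage (D : cs.Realization V Vd) (A : Set (cs.Reflections × ℤˣ)) : Set V :=
  {β | ∃ x ∈ A, D.Proj β x}

/-- The transferred closure operator `c_Φ(A) = π(cone_Φ(π⁻¹(A)))` on `T × {±1}`. -/
def abstractClosure (D : cs.Realization V Vd) (A : Set (cs.Reflections × ℤˣ)) :
    Set (cs.Reflections × ℤˣ) :=
  {x | ∃ β ∈ D.coneClosure (D.preimage A), D.Proj β x}

/-- `O` is the oriented matroid `(T × {±1}, -, c_Φ)` given by the realized root system. -/
def Induces (D : cs.Realization V Vd) (O : OrientedMatroid (cs.Reflections × ℤˣ)) : Prop :=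
  (∀ t ε, O.inv (t, ε) = (t, -ε)) ∧ ∀ A, O.cl A = D.abstractClosure A

end Realization

end CoxeterSystem

/-! ### Affine Weyl groups -/

namespace RootPairing

variable {ι E F : Type*} [AddCommGroup E] [Module ℝ E] [AddCommGroup F] [Module ℝ F]

/-- The affine reflection `x ↦ x - (⟨α, x⟩ - k) α^∨` in the hyperplane `⟨α, x⟩ = k`, where `α`
is the root with index `a`. -/
noncomputable def affineReflection (P : RootPairing ι ℝ E F) (a : ι) (k : ℤ) : F ≃ᵃ[ℝ] F :=
  (P.coreflection a).toAffineEquiv.trans (AffineEquiv.constVAdd ℝ F ((k : ℝ) • P.coroot a))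

/-- The affine Weyl group of a root system, generated by all affine reflections in the hyperplanes
`⟨α, x⟩ = k` with `α` a root and `k` an integer. -/
def affineWeylGroup (P : RootPairing ι ℝ E F) : Subgroup (F ≃ᵃ[ℝ] F) :=
  Subgroup.closure {g | ∃ a k, g = P.affineReflection a k}

/-- The root with index `θ` is the highest root with respect to the base `b`. -/
def Base.IsHighest {P : RootPairing ι ℝ E F} (b : P.Base) (θ : ι) : Prop :=
  ∀ a, P.root θ - P.root a ∈ AddSubmonoid.closure (P.root '' b.support)

/-- The canonical generators of the affine Weyl group: the reflections in the simple roots, and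
the affine reflection in the hyperplane `⟨θ, x⟩ = 1` with `θ` the highest root. -/
noncomputable def Base.affineSimple {P : RootPairing ι ℝ E F} (b : P.Base) (θ : ι) :
    Option b.support → (F ≃ᵃ[ℝ] F)
  | none => P.affineReflection θ 1
  | some a => P.affineReflection a 0

end RootPairing

/-- The Coxeter system `(W, S)` is an irreducible affine Weyl group: it is isomorphic to the affine
Weyl group of an irreducible reduced crystallographic root system with its canonical generators. -/
def CoxeterSystem.IsIrreducibleAffineWeyl {B W : Type*} [Group W] {M : CoxeterMatrix B}
    (cs : CoxeterSystem M W) : Prop :=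
  ∃ (ι E F : Type) (_ : Finite ι) (_ : AddCommGroup E) (_ : Module ℝ E) (_ : AddCommGroup F)
    (_ : Module ℝ F) (P : RootPairing ι ℝ E F) (_ : P.IsRootSystem) (_ : P.IsCrystallographic)
    (_ : P.IsReduced) (_ : P.IsIrreducible) (b : P.Base) (θ : ι) (_ : b.IsHighest θ)
    (e : B ≃ Option b.support) (f : W ≃* P.affineWeylGroup),
    ∀ i, (f (cs.simple i) : F ≃ᵃ[ℝ] F) = b.affineSimple θ (e i)

/-- The Coxeter matrix is of type `Ã_n` for some `n ≥ 1`: the Coxeter graph is a cycle with `n + 1`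
vertices and no labels if `n ≥ 2`, and a single edge with label `∞` (encoded as `0`) if `n = 1`. -/
def CoxeterMatrix.IsTypeATilde {B : Type*} (M : CoxeterMatrix B) : Prop :=
  ∃ n : ℕ, 1 ≤ n ∧ ∃ e : B ≃ ZMod (n + 1), ∀ i j, M i j =
    if e i = e j then 1
    else if n = 1 then 0
    else if e j = e i + 1 ∨ e i = e j + 1 then 3
    else 2

/-!
Write `m_ij` for the labels of the Coxeter matrix and `C` for the matrix with entries
`-cos(π / m_ij)`. Every Coxeter group acts on `B →₀ ℝ` by its geometric representation, whose Cartan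
matrix is `2 C`; it shows that `m_ij` is the exact order of `s_i s_j`
(`CoxeterSystem.orderOf_simple_mul_simple`). The point is that, under the hypotheses, every
realization is the geometric representation up to positive rescaling of the simple roots.

Comparing orders, `a_ij a_ji = 4 cos²(π / m_ij)` for the Cartan matrix `a` of any realization
(`Realization.pairing_mul_pairing_eq`), so only the ratios `a_ij / a_ji` are free. Two things are
needed.

* The ratios can be removed by rescaling, `Realization.IsNormalizedBy`. If `W` is finite, take unit
  vectors for an averaged inner product. In the affine case `C` is the Gram matrix of the unit
  normals to the walls of the fundamental alcove, so it is positive semidefinite with kernel spanned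
  by a positive vector (`IsIrreducibleAffineWeyl.exists_isAffine`). A cycle in the Coxeter graph
  would have an isotropic indicator vector, which forces type `Ã_n` (`IsAffine.isAcyclic`); on an
  acyclic graph the ratios come from a potential (`SimpleGraph.IsAcyclic.exists_potential`).
* The simple roots, only assumed positively independent, are linearly independent. In the finite case
  they are pairwise obtuse; in the affine case a relation between them is a kernel vector of `C`,
  hence has coefficients of one sign.

A normalized realization then receives an injective equivariant map from `B →₀ ℝ` carrying the basis
vectors to positive multiples of the simple roots, and so gives the same closure operator on
`T × {±1}` as the geometric representation (`IsNormalizedBy.induces`). For the latter, each root is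
positive or negative, according to lengths (`CoxeterSystem.geometricRoot_nonneg`), each reflection
has a positive root, unique up to a factor, and a configuration of vectors closed under negation
always defines an oriented matroid (`OrientedMatroid.ofVectors`).
-/

/-! ### Trigonometry and Chebyshev polynomials at `cos(π / m)` -/

section

open Polynomial.Chebyshev

lemma Real.sin_pi_div_natCast_pos {m : ℕ} (hm : 2 ≤ m) : 0 < Real.sin (Real.pi / m) := by
  have hm' : (2 : ℝ) ≤ m := by exact_mod_cast hm
  refine Real.sin_pos_of_pos_of_lt_pi (by positivity) ?_
  rw [div_lt_iff₀ (by linarith)]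
  nlinarith [Real.pi_pos]

lemma Real.cos_pi_div_natCast_nonneg {m : ℕ} (hm : 2 ≤ m) : 0 ≤ Real.cos (Real.pi / m) := by
  have hm' : (2 : ℝ) ≤ m := by exact_mod_cast hm
  have : Real.pi / m ≤ Real.pi / 2 := by gcongr
  exact Real.cos_nonneg_of_neg_pi_div_two_le_of_le
    (by have : 0 < Real.pi / m := by positivity
        linarith [Real.pi_pos]) this

lemma Real.cos_pi_div_natCast_sq_lt_one {m : ℕ} (hm : 2 ≤ m) : Real.cos (Real.pi / m) ^ 2 < 1 := by
  have := Real.sin_sq_add_cos_sq (Real.pi / m)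
  nlinarith [Real.sin_pi_div_natCast_pos hm]

lemma Polynomial.Chebyshev.U_eval_cos_pi_div {m : ℕ} (hm : 2 ≤ m) (k : ℤ) :
    (U ℝ k).eval (Real.cos (Real.pi / m)) =
      Real.sin ((k + 1) * (Real.pi / m)) / Real.sin (Real.pi / m) := by
  rw [eq_div_iff (Real.sin_pi_div_natCast_pos hm).ne', U_real_cos]

lemma Real.cos_pi_div_natCast_inj {m n : ℕ} (hm : m ≠ 0) (hn : n ≠ 0)
    (h : Real.cos (Real.pi / m) = Real.cos (Real.pi / n)) : m = n := by
  have hm' : (0 : ℝ) < m := by exact_mod_cast Nat.pos_of_ne_zero hm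
  have hn' : (0 : ℝ) < n := by exact_mod_cast Nat.pos_of_ne_zero hn
  have hmem : ∀ l : ℕ, l ≠ 0 → Real.pi / l ∈ Set.Icc 0 Real.pi := by
    intro l hl
    have hl' : (1 : ℝ) ≤ l := by exact_mod_cast Nat.one_le_iff_ne_zero.2 hl
    exact ⟨by positivity, div_le_self Real.pi_pos.le hl'⟩
  have := Real.injOn_cos (hmem m hm) (hmem n hn) h
  have hpi := Real.pi_pos
  field_simp at this
  exact_mod_cast this.symm

lemma Polynomial.Chebyshev.U_eval_cos_pi_div_nonneg {m : ℕ} (hm : 2 ≤ m) {k : ℤ}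
    (h0 : -1 ≤ k) (hk : k < m) :
    0 ≤ (U ℝ k).eval (Real.cos (Real.pi / m)) := by
  rw [Polynomial.Chebyshev.U_eval_cos_pi_div hm]
  have hm' : (0 : ℝ) < m := by exact_mod_cast (by omega : 0 < m)
  have h0' : (0 : ℝ) ≤ k + 1 := by exact_mod_cast (by omega : 0 ≤ k + 1)
  have hk' : (k : ℝ) + 1 ≤ m := by exact_mod_cast (by omega : k + 1 ≤ m)
  refine div_nonneg (Real.sin_nonneg_of_nonneg_of_le_pi (by positivity) ?_)
    (Real.sin_pi_div_natCast_pos hm).le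
  calc ((k : ℝ) + 1) * (Real.pi / m) ≤ m * (Real.pi / m) := by gcongr
    _ = Real.pi := by field_simp

lemma Polynomial.Chebyshev.U_eval_lt_U_eval_succ {c : ℝ} (hc : 1 ≤ c) (n : ℕ) :
    0 ≤ (U ℝ (n - 1)).eval c ∧ (U ℝ (n - 1)).eval c < (U ℝ n).eval c := by
  induction n with
  | zero => simp
  | succ n ih =>
    have := congrArg (Polynomial.eval c) (U_add_one ℝ n)
    simp only [Polynomial.eval_sub, Polynomial.eval_mul, Polynomial.eval_ofNat,
      Polynomial.eval_X] at this
    push_cast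
    rw [add_sub_cancel_right, this]
    constructor <;> nlinarith

end

/-! ### Products of two reflections -/

namespace Module

variable {V : Type*} [AddCommGroup V] [Module ℝ V]

section

open Polynomial.Chebyshev

variable {x y : V} {f g : Dual ℝ V} {c : ℝ}

/-- The orbit of `x` under powers of a product of two reflections, when the two mutual pairings
both equal `-2c`; the coefficients are Chebyshev polynomials of the second kind at `c`. -/
lemma reflection_mul_reflection_pow_apply_left (hf : f x = 2) (hg : g y = 2)
    (hfy : f y = -(2 * c)) (hgx : g x = -(2 * c)) (n : ℕ) :
    ((reflection hf * reflection hg) ^ n) x =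
      (U ℝ (2 * n)).eval c • x + (U ℝ (2 * n - 1)).eval c • y := by
  induction n with
  | zero => simp
  | succ n ih =>
    have e1 : (U ℝ (2 * (n + 1 : ℕ) - 1)).eval c =
        2 * c * (U ℝ (2 * n)).eval c - (U ℝ (2 * n - 1)).eval c := by
      have := congrArg (Polynomial.eval c) (U_add_one ℝ (2 * n))
      simp only [Polynomial.eval_sub, Polynomial.eval_mul, Polynomial.eval_ofNat,
        Polynomial.eval_X] at this
      rw [← this]; push_cast; congr 2; ring
    have e2 : (U ℝ (2 * (n + 1 : ℕ))).eval c =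
        2 * c * (U ℝ (2 * (n + 1 : ℕ) - 1)).eval c - (U ℝ (2 * n)).eval c := by
      have := congrArg (Polynomial.eval c) (U_add_two ℝ (2 * n))
      simp only [Polynomial.eval_sub, Polynomial.eval_mul, Polynomial.eval_ofNat,
        Polynomial.eval_X] at this
      push_cast
      rw [show 2 * ((n : ℤ) + 1) = 2 * n + 2 by ring,
        show (2 * (n : ℤ) + 2 - 1) = 2 * n + 1 by ring]
      exact this
    rw [pow_succ', LinearEquiv.mul_apply, ih, e2, e1]
    simp only [LinearEquiv.mul_apply, map_add, map_smul, reflection_apply, hf, hg, hfy, hgx, map_sub]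
    module

/-- The companion of `reflection_mul_reflection_pow_apply_left` for the second vector. -/
lemma reflection_mul_reflection_pow_apply_right (hf : f x = 2) (hg : g y = 2)
    (hfy : f y = -(2 * c)) (hgx : g x = -(2 * c)) (n : ℕ) :
    ((reflection hf * reflection hg) ^ n) y =
      -(U ℝ (2 * n - 1)).eval c • x - (U ℝ (2 * n - 2)).eval c • y := by
  induction n with
  | zero => simp
  | succ n ih =>
    have e1 : (U ℝ (2 * (n + 1 : ℕ) - 2)).eval c =
        2 * c * (U ℝ (2 * n - 1)).eval c - (U ℝ (2 * n - 2)).eval c := by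
      have := congrArg (Polynomial.eval c) (U_eq ℝ (2 * n))
      simp only [Polynomial.eval_sub, Polynomial.eval_mul, Polynomial.eval_ofNat,
        Polynomial.eval_X] at this
      rw [← this]; push_cast; congr 2; ring
    have e2 : (U ℝ (2 * (n + 1 : ℕ) - 1)).eval c =
        2 * c * (U ℝ (2 * (n + 1 : ℕ) - 2)).eval c - (U ℝ (2 * n - 1)).eval c := by
      have := congrArg (Polynomial.eval c) (U_add_one ℝ (2 * n))
      simp only [Polynomial.eval_sub, Polynomial.eval_mul, Polynomial.eval_ofNat,
        Polynomial.eval_X] at this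
      push_cast
      rw [show 2 * ((n : ℤ) + 1) - 1 = 2 * n + 1 by ring,
        show 2 * ((n : ℤ) + 1) - 2 = 2 * n by ring]
      exact this
    rw [pow_succ', LinearEquiv.mul_apply, ih, e2, e1]
    simp only [LinearEquiv.mul_apply, map_smul, reflection_apply, hf, hg, hfy, hgx, map_sub]
    module

/-- If two vectors pair as `-2c` with `c² < 1`, they are linearly independent; this is the form in
which the independence is used. -/
lemma eq_zero_of_smul_add_smul_eq_zero (hf : f x = 2) (hg : g y = 2)
    (hfy : f y = -(2 * c)) (hgx : g x = -(2 * c)) (hc : c ^ 2 < 1) {p q : ℝ}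
    (h : p • x + q • y = 0) : p = 0 ∧ q = 0 := by
  have h1 := congrArg f h
  have h2 := congrArg g h
  simp only [map_add, map_smul, hf, hg, hfy, hgx, smul_eq_mul, map_zero] at h1 h2
  have hp : p = c * q := by linarith
  have hq : q = c * p := by linarith
  have : p * (1 - c ^ 2) = 0 := by rw [hq] at hp; linear_combination hp
  have hp0 : p = 0 := by
    rcases mul_eq_zero.1 this with h | h
    · exact h
    · linarith
  exact ⟨hp0, by rw [hq, hp0, mul_zero]⟩

lemma orderOf_reflection_mul_reflection_of_eq {m : ℕ} (hm : 2 ≤ m) (hf : f x = 2) (hg : g y = 2)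
    (hfy : f y = -(2 * Real.cos (Real.pi / m))) (hgx : g x = -(2 * Real.cos (Real.pi / m))) :
    orderOf (reflection hf * reflection hg) = m := by
  set c := Real.cos (Real.pi / m) with hcdef
  have hc : c ^ 2 < 1 := Real.cos_pi_div_natCast_sq_lt_one hm
  have hs := Real.sin_pi_div_natCast_pos hm
  have hm0 : (m : ℝ) ≠ 0 := by
    have : m ≠ 0 := by omega
    exact_mod_cast this
  apply Nat.dvd_antisymm
  · apply orderOf_dvd_of_pow_eq_one
    have u0 : (U ℝ (2 * m)).eval c = 1 := by
      rw [hcdef, Polynomial.Chebyshev.U_eval_cos_pi_div hm, div_eq_one_iff_eq hs.ne']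
      rw [show (((2 * m : ℤ) : ℝ) + 1) * (Real.pi / m) = Real.pi / m + 2 * Real.pi by
        push_cast; field_simp; ring, Real.sin_add_two_pi]
    have u1 : (U ℝ (2 * m - 1)).eval c = 0 := by
      rw [hcdef, Polynomial.Chebyshev.U_eval_cos_pi_div hm, div_eq_zero_iff]
      left
      rw [show (((2 * m - 1 : ℤ) : ℝ) + 1) * (Real.pi / m) = 2 * Real.pi by
        push_cast; field_simp; ring, Real.sin_two_pi]
    have u2 : (U ℝ (2 * m - 2)).eval c = -1 := by
      rw [hcdef, Polynomial.Chebyshev.U_eval_cos_pi_div hm, div_eq_iff hs.ne']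
      rw [show (((2 * m - 2 : ℤ) : ℝ) + 1) * (Real.pi / m) = -(Real.pi / m) + 2 * Real.pi by
        push_cast; field_simp; ring, Real.sin_add_two_pi, Real.sin_neg, neg_one_mul]
    ext v
    -- Split off the component of `v` in the plane of `x` and `y`; the rest is fixed.
    set p := (f v + c * g v) / (2 * (1 - c ^ 2)) with hp
    set q := (g v + c * f v) / (2 * (1 - c ^ 2)) with hq
    set v₀ := v - p • x - q • y with hv₀
    have hd : 1 - c ^ 2 ≠ 0 := by linarith
    have hfv : f v₀ = 0 := by
      simp only [hv₀, map_sub, map_smul, hf, hfy, smul_eq_mul, hp, hq]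
      field_simp; ring
    have hgv : g v₀ = 0 := by
      simp only [hv₀, map_sub, map_smul, hg, hgx, smul_eq_mul, hp, hq]
      field_simp; ring
    have hfix : ∀ n : ℕ, ((reflection hf * reflection hg) ^ n) v₀ = v₀ := by
      intro n
      induction n with
      | zero => simp
      | succ n ih => rw [pow_succ', LinearEquiv.mul_apply, ih]; simp [reflection_apply, hfv, hgv]
    have hv : v = v₀ + p • x + q • y := by rw [hv₀]; module
    rw [hv, map_add, map_add, map_smul, map_smul, hfix,
      reflection_mul_reflection_pow_apply_left hf hg hfy hgx,
      reflection_mul_reflection_pow_apply_right hf hg hfy hgx, u0, u1, u2]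
    simp
  · set n := orderOf (reflection hf * reflection hg)
    have h := congrArg (fun e : V ≃ₗ[ℝ] V ↦ e x) (pow_orderOf_eq_one (reflection hf * reflection hg))
    simp only [LinearEquiv.coe_one, id] at h
    rw [reflection_mul_reflection_pow_apply_left hf hg hfy hgx] at h
    obtain ⟨h1, h2⟩ := eq_zero_of_smul_add_smul_eq_zero hf hg hfy hgx hc
      (p := (U ℝ (2 * n)).eval c - 1) (q := (U ℝ (2 * n - 1)).eval c)
      (by rw [sub_smul, one_smul, sub_add_eq_add_sub, sub_eq_zero]; exact h)
    rw [sub_eq_zero, hcdef, Polynomial.Chebyshev.U_eval_cos_pi_div hm, div_eq_one_iff_eq hs.ne'] at h1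
    rw [hcdef, Polynomial.Chebyshev.U_eval_cos_pi_div hm, div_eq_zero_iff, or_iff_left hs.ne'] at h2
    push_cast at h1 h2
    have h3 : Real.cos (2 * n * (Real.pi / m)) = 1 := by
      rw [sub_add_cancel] at h2
      rw [add_mul, one_mul, Real.sin_add, h2, zero_mul, zero_add] at h1
      exact mul_right_cancel₀ hs.ne' (by rw [h1, one_mul])
    obtain ⟨k, hk⟩ := (Real.cos_eq_one_iff _).1 h3
    have hk' : (k : ℝ) * m = n := by
      field_simp at hk
      linarith
    have hk'' : (k : ℤ) * m = n := by exact_mod_cast hk'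
    exact Int.natCast_dvd_natCast.1 ⟨k, by rw [← hk'']; ring⟩

lemma reflection_mul_reflection_pow_ne_one_of_eq (hc : 1 ≤ c) (hf : f x = 2) (hg : g y = 2)
    (hfy : f y = -(2 * c)) (hgx : g x = -(2 * c))
    (hpos : ∀ p q : ℝ, 0 < p → 0 < q → p • x + q • y ≠ 0) {n : ℕ} (hn : n ≠ 0) :
    (reflection hf * reflection hg) ^ n ≠ 1 := by
  intro h
  have h := congrArg (fun e : V ≃ₗ[ℝ] V ↦ e x) h
  simp only [LinearEquiv.coe_one, id] at h
  rw [reflection_mul_reflection_pow_apply_left hf hg hfy hgx] at h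
  have key : ∀ k : ℕ, 1 ≤ (U ℝ k).eval c := by
    intro k
    induction k with
    | zero => simp
    | succ k ih =>
      have := (Polynomial.Chebyshev.U_eval_lt_U_eval_succ hc (k + 1)).2
      push_cast at this ⊢
      rw [add_sub_cancel_right] at this
      linarith
  obtain ⟨k, hk⟩ : ∃ k, 2 * n - 1 = k + 1 := ⟨2 * n - 2, by omega⟩
  have h1 := (Polynomial.Chebyshev.U_eval_lt_U_eval_succ hc (2 * n)).2
  have h2 := key (k + 1)
  have e : (2 * (n : ℤ) - 1) = ((k + 1 : ℕ) : ℤ) := by omega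
  push_cast at h1
  rw [e] at h1 h
  exact hpos ((U ℝ (2 * n)).eval c - 1) ((U ℝ ((k + 1 : ℕ) : ℤ)).eval c) (by linarith) (by linarith)
    (by rw [sub_smul, one_smul, sub_add_eq_add_sub, sub_eq_zero]; exact h)

end

section

variable {x y : V} {f g : Dual ℝ V}

lemma reflection_smul_inv_smul {a : ℝ} (ha : a ≠ 0) (hg : g y = 2)
    (hg' : (a⁻¹ • g) (a • y) = 2) : reflection hg' = reflection hg := by
  ext v
  simp [reflection_apply, smul_smul, mul_right_comm, ha]

/-- Two nonpositive numbers vanishing together are both brought to the form `-2c` with `c ≥ 0` by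
rescaling. -/
lemma exists_rescale {a b c : ℝ} (ha : a ≤ 0) (hb : b ≤ 0) (hab : a = 0 ↔ b = 0) (hc : 0 ≤ c)
    (h : a * b = 4 * c ^ 2) : ∃ t : ℝ, 0 < t ∧ t * a = -(2 * c) ∧ t⁻¹ * b = -(2 * c) := by
  rcases eq_or_ne a 0 with h0 | h0
  · have hb0 := hab.1 h0
    have : c = 0 := by
      rw [h0, zero_mul] at h
      nlinarith
    exact ⟨1, one_pos, by simp [h0, this], by simp [hb0, this]⟩
  · have ha' : a < 0 := lt_of_le_of_ne ha h0
    have hb' : b < 0 := lt_of_le_of_ne hb (fun hb0 ↦ h0 (hab.2 hb0))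
    have hc' : 0 < c := by
      rcases hc.eq_or_lt with h1 | h1
      · rw [← h1] at h; nlinarith [mul_pos_of_neg_of_neg ha' hb']
      · exact h1
    refine ⟨2 * c / -a, div_pos (by linarith) (by linarith), by field_simp, ?_⟩
    rw [inv_div]
    field_simp
    linarith

/-- The order of a product of two reflections is read off from the product of the two pairings. -/
lemma orderOf_reflection_mul_reflection {m : ℕ} (hm : 2 ≤ m) (hf : f x = 2) (hg : g y = 2)
    (hfy : f y ≤ 0) (hgx : g x ≤ 0) (hfg : f y = 0 ↔ g x = 0)
    (h : f y * g x = 4 * Real.cos (Real.pi / m) ^ 2) :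
    orderOf (reflection hf * reflection hg) = m := by
  obtain ⟨t, ht, h1, h2⟩ := exists_rescale hfy hgx hfg (Real.cos_pi_div_natCast_nonneg hm) h
  have hg' : (t⁻¹ • g) (t • y) = 2 := by simp [ht.ne', hg]
  rw [← reflection_smul_inv_smul ht.ne' hg hg']
  exact orderOf_reflection_mul_reflection_of_eq hm hf hg' (by simpa using h1) (by simpa using h2)

/-- Beyond the range of the cosines, a product of two reflections has infinite order. -/
lemma reflection_mul_reflection_pow_ne_one (hf : f x = 2) (hg : g y = 2)
    (hfy : f y ≤ 0) (hgx : g x ≤ 0) (h : 4 ≤ f y * g x)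
    (hpos : ∀ p q : ℝ, 0 < p → 0 < q → p • x + q • y ≠ 0) {n : ℕ} (hn : n ≠ 0) :
    (reflection hf * reflection hg) ^ n ≠ 1 := by
  have hfg : f y = 0 ↔ g x = 0 := by
    constructor <;> (intro h0; rw [h0] at h; norm_num at h)
  have hc : 1 ≤ √(f y * g x / 4) := Real.one_le_sqrt.2 (by linarith)
  obtain ⟨t, ht, h1, h2⟩ := exists_rescale hfy hgx hfg (Real.sqrt_nonneg _)
    (by rw [Real.sq_sqrt (by linarith)]; ring : f y * g x = 4 * √(f y * g x / 4) ^ 2)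
  have hg' : (t⁻¹ • g) (t • y) = 2 := by simp [ht.ne', hg]
  rw [← reflection_smul_inv_smul ht.ne' hg hg']
  refine reflection_mul_reflection_pow_ne_one_of_eq hc hf hg' (by simpa using h1) (by simpa using h2)
    (fun p q hp hq ↦ ?_) hn
  rw [smul_smul]
  exact hpos p _ hp (by positivity)

end

end Module

/-! ### The geometric representation -/

namespace CoxeterMatrix

variable {B : Type*} (M : CoxeterMatrix B)

/-- The linear form on `B →₀ ℝ` taking the value `-2 cos(π / m_ij)` on the `j`-th basis vector.
An infinite label is encoded as `m_ij = 0`, and the convention `π / 0 = 0` gives the value `-2`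
wanted in that case. -/
noncomputable def geometricCoroot (i : B) : Module.Dual ℝ (B →₀ ℝ) :=
  Finsupp.linearCombination ℝ fun j ↦ -(2 * Real.cos (Real.pi / M i j))

lemma geometricCoroot_single (i j : B) :
    M.geometricCoroot i (Finsupp.single j 1) = -(2 * Real.cos (Real.pi / M i j)) := by
  simp [geometricCoroot]

lemma geometricCoroot_single_self (i : B) :
    M.geometricCoroot i (Finsupp.single i 1) = 2 := by
  simp [geometricCoroot_single]

/-- The reflection of `B →₀ ℝ` attached to a vertex of the Coxeter graph. -/
noncomputable def geometricReflection (i : B) : (B →₀ ℝ) ≃ₗ[ℝ] (B →₀ ℝ) :=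
  Module.reflection (M.geometricCoroot_single_self i)

lemma geometricReflection_single (i j : B) :
    M.geometricReflection j (Finsupp.single i 1) =
      Finsupp.single i 1 + (2 * Real.cos (Real.pi / M i j)) • Finsupp.single j (1 : ℝ) := by
  rw [geometricReflection, Module.reflection_apply, geometricCoroot_single, M.symmetric j i,
    neg_smul, sub_neg_eq_add]

lemma two_le_of_ne {i j : B} (h : i ≠ j) (h0 : M i j ≠ 0) : 2 ≤ M i j := by
  have := M.off_diagonal i j h
  omega

lemma orderOf_geometricReflection_mul (i j : B) :
    orderOf (M.geometricReflection i * M.geometricReflection j) = M i j := by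
  rcases eq_or_ne i j with rfl | hij
  · rw [M.diagonal, orderOf_eq_one_iff]
    refine LinearEquiv.ext fun v ↦ ?_
    rw [LinearEquiv.mul_apply]
    exact Module.involutive_reflection (M.geometricCoroot_single_self i) v
  have hji : M j i = M i j := M.symmetric j i
  unfold geometricReflection
  rcases eq_or_ne (M i j) 0 with h0 | h0
  · rw [h0, orderOf_eq_zero_iff']
    intro n hn
    refine Module.reflection_mul_reflection_pow_ne_one_of_eq (c := 1) le_rfl
      (M.geometricCoroot_single_self i) (M.geometricCoroot_single_self j) ?_ ?_ ?_ hn.ne'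
    · rw [geometricCoroot_single, h0]; simp
    · rw [geometricCoroot_single, hji, h0]; simp
    · intro p q hp _ h
      have := DFunLike.congr_fun h i
      simp [hij.symm] at this
      exact hp.ne' this
  · refine Module.orderOf_reflection_mul_reflection_of_eq (M.two_le_of_ne hij h0)
      (M.geometricCoroot_single_self i) (M.geometricCoroot_single_self j) ?_ ?_
    · rw [geometricCoroot_single]
    · rw [geometricCoroot_single, hji]

end CoxeterMatrix

namespace CoxeterSystem

variable {B W : Type*} [Group W] {M : CoxeterMatrix B} (cs : CoxeterSystem M W)

/-- The geometric representation of a Coxeter group on `B →₀ ℝ`. -/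
noncomputable def geometricRep : W →* ((B →₀ ℝ) ≃ₗ[ℝ] (B →₀ ℝ)) :=
  cs.lift ⟨M.geometricReflection, fun i j ↦ by
    rw [← M.orderOf_geometricReflection_mul i j, pow_orderOf_eq_one]⟩

lemma geometricRep_simple (i : B) : cs.geometricRep (cs.simple i) = M.geometricReflection i :=
  cs.lift_apply_simple _ i

/-- The label `m_ij` is the exact order of `s_i s_j`. -/
lemma orderOf_simple_mul_simple (i j : B) : orderOf (cs.simple i * cs.simple j) = M i j := by
  apply Nat.dvd_antisymm (orderOf_dvd_of_pow_eq_one (cs.simple_mul_simple_pow i j))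
  have h := orderOf_map_dvd cs.geometricRep (cs.simple i * cs.simple j)
  rwa [map_mul, geometricRep_simple, geometricRep_simple, M.orderOf_geometricReflection_mul] at h

/-- The root `w(e_i)` of the geometric representation. -/
noncomputable def geometricRoot (w : W) (i : B) : B →₀ ℝ :=
  cs.geometricRep w (Finsupp.single i 1)

lemma geometricRoot_one (i : B) : cs.geometricRoot 1 i = Finsupp.single i 1 := by
  simp [geometricRoot]

lemma geometricRoot_mul_simple (w : W) (i j : B) :
    cs.geometricRoot (w * cs.simple j) i =
      cs.geometricRoot w i + (2 * Real.cos (Real.pi / M i j)) • cs.geometricRoot w j := by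
  simp only [geometricRoot, map_mul, LinearEquiv.mul_apply, geometricRep_simple,
    M.geometricReflection_single, map_add, map_smul]

lemma geometricRoot_mul_simple_self (w : W) (i : B) :
    cs.geometricRoot (w * cs.simple i) i = -cs.geometricRoot w i := by
  rw [geometricRoot_mul_simple, M.diagonal]
  simp only [Nat.cast_one, div_one, Real.cos_pi]
  module

lemma geometricRoot_ne_zero (w : W) (i : B) : cs.geometricRoot w i ≠ 0 := by
  simp [geometricRoot]

open Polynomial.Chebyshev in
/-- Translates of a simple root by an alternating word in two generators. -/
lemma geometricRoot_mul_alternatingWord (v : W) (i j : B) (k : ℕ) :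
    cs.geometricRoot (v * cs.wordProd (alternatingWord i j k)) i =
      (U ℝ (if Even k then (k : ℤ) else k - 1)).eval (Real.cos (Real.pi / M i j)) •
          cs.geometricRoot v i +
        (U ℝ (if Even k then (k : ℤ) - 1 else k)).eval (Real.cos (Real.pi / M i j)) •
          cs.geometricRoot v j := by
  induction k generalizing v with
  | zero => simp [alternatingWord]
  | succ k ih =>
    set c := Real.cos (Real.pi / M i j) with hc
    have hU : (U ℝ (k + 1)).eval c = 2 * c * (U ℝ k).eval c - (U ℝ (k - 1)).eval c := by
      have := congrArg (Polynomial.eval c) (U_add_one ℝ k)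
      simpa only [Polynomial.eval_sub, Polynomial.eval_mul, Polynomial.eval_ofNat,
        Polynomial.eval_X] using this
    rw [alternatingWord_succ', wordProd_cons, ← mul_assoc, ih]
    by_cases hk : Even k
    · have hk' : ¬ Even (k + 1) := by rwa [Nat.even_add_one, not_not]
      simp only [if_pos hk, if_neg hk']
      rw [geometricRoot_mul_simple_self, geometricRoot_mul_simple, ← hc]
      push_cast
      rw [add_sub_cancel_right, hU]
      module
    · have hk' : Even (k + 1) := by rwa [Nat.even_add_one]
      simp only [if_neg hk, if_pos hk']
      rw [geometricRoot_mul_simple_self, geometricRoot_mul_simple, M.symmetric j i, ← hc]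
      push_cast
      rw [add_sub_cancel_right, hU]
      module

/-- If right multiplication by `s_i` lengthens `w`, then `w(e_i)` is a nonnegative combination of
the simple roots. The induction peels off from `w` on the right the longest possible element of a
dihedral parabolic subgroup. -/
theorem geometricRoot_nonneg (hM : ∀ i j, M i j ≠ 0) (w : W) (i : B)
    (h : cs.length w < cs.length (w * cs.simple i)) : 0 ≤ cs.geometricRoot w i := by
  induction hn : cs.length w using Nat.strong_induction_on generalizing w i with
  | _ n ih =>
  subst hn
  by_cases hw : w = 1
  · subst hw
    rw [geometricRoot_one]
    simp
  obtain ⟨j, hj⟩ := cs.exists_rightDescent_of_ne_one hw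
  have hij : i ≠ j := by
    rintro rfl
    exact absurd hj (not_lt.2 h.le)
  have hm : 2 ≤ M i j := M.two_le_of_ne hij (hM i j)
  set u : ℕ → W := fun k ↦ cs.wordProd (alternatingWord i j k) with hu
  have hlen : ∀ k, cs.length (u k) ≤ k := fun k ↦
    (cs.length_wordProd_le _).trans (length_alternatingWord i j k).le
  have hsucc : ∀ k, u (k + 1) = cs.simple (if Even k then j else i) * u k := fun k ↦ by
    simp only [hu]
    rw [alternatingWord_succ', wordProd_cons]
  let P : ℕ → Prop := fun k ↦ cs.length (w * (u k)⁻¹) + k = cs.length w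
  classical
  set k := Nat.findGreatest P (M i j) with hk
  have hP1 : P 1 := by
    have : u 1 = cs.simple j := by simp [hu, alternatingWord]
    simp only [P, this, inv_simple]
    exact cs.isRightDescent_iff.1 hj
  have hk1 : 1 ≤ k := Nat.le_findGreatest (by omega) hP1
  have hkm : k ≤ M i j := Nat.findGreatest_le _
  have hPk : P k := Nat.findGreatest_spec (by omega : 1 ≤ M i j) hP1
  set v := w * (u k)⁻¹ with hv
  have hPk' : cs.length v + k = cs.length w := hPk
  have hwv : w = v * u k := by rw [hv, inv_mul_cancel_right]
  have hklt : k < M i j := by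
    -- A full braid word could be rewritten to end in `s_i`, making `w s_i` shorter than `w`.
    refine lt_of_le_of_ne hkm fun hkeq ↦ ?_
    have hb : u k = u (k - 1) * cs.simple i := by
      have hb1 := cs.wordProd_braidWord_eq i j
      unfold braidWord at hb1
      rw [M.symmetric j i, ← hkeq] at hb1
      obtain ⟨l, hl⟩ : ∃ l, k = l + 1 := ⟨k - 1, by omega⟩
      simp only [hu]
      rw [hb1, hl, alternatingWord_succ, wordProd_concat, Nat.add_sub_cancel]
    have hws : w * cs.simple i = v * u (k - 1) := by
      rw [hwv, hb, ← mul_assoc, cs.simple_mul_simple_cancel_right]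
    have h1 := cs.length_mul_le v (u (k - 1))
    have h2 := hlen (k - 1)
    rw [← hws] at h1
    omega
  -- Neither generator of the dihedral subgroup shortens `v`.
  have hvx : cs.length v < cs.length (v * cs.simple (if Even k then j else i)) := by
    by_contra hcon
    have h1 := cs.length_mul_simple v (if Even k then j else i)
    have : P (k + 1) := by
      simp only [P]
      rw [hsucc, mul_inv_rev, inv_simple, ← mul_assoc, ← hv]
      omega
    have h2 := Nat.le_findGreatest (n := M i j) (by omega) this
    omega
  have hvy : cs.length v < cs.length (v * cs.simple (if Even (k - 1) then j else i)) := by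
    obtain ⟨l, hl⟩ : ∃ l, k = l + 1 := ⟨k - 1, by omega⟩
    have h1 : v * cs.simple (if Even (k - 1) then j else i) = w * (u (k - 1))⁻¹ := by
      rw [hv, hl, hsucc, Nat.add_sub_cancel, mul_inv_rev, inv_simple, mul_assoc, mul_assoc,
        cs.simple_mul_simple_self, mul_one]
    rw [h1]
    have h2 := cs.length_mul_le (w * (u (k - 1))⁻¹) (u (k - 1))
    rw [inv_mul_cancel_right] at h2
    have h3 := hlen (k - 1)
    omega
  have hboth : cs.length v < cs.length (v * cs.simple i) ∧
      cs.length v < cs.length (v * cs.simple j) := by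
    have hpar : Even (k - 1) ↔ ¬ Even k := by
      obtain ⟨l, hl⟩ : ∃ l, k = l + 1 := ⟨k - 1, by omega⟩
      rw [hl, Nat.add_sub_cancel, Nat.even_add_one, not_not]
    by_cases he : Even k
    · rw [if_pos he] at hvx
      rw [if_neg (by rw [hpar]; simpa using he)] at hvy
      exact ⟨hvy, hvx⟩
    · rw [if_neg he] at hvx
      rw [if_pos (hpar.2 he)] at hvy
      exact ⟨hvx, hvy⟩
  have hvi := ih (cs.length v) (by omega) v i hboth.1 rfl
  have hvj := ih (cs.length v) (by omega) v j hboth.2 rfl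
  rw [hwv, geometricRoot_mul_alternatingWord]
  refine add_nonneg (smul_nonneg (Polynomial.Chebyshev.U_eval_cos_pi_div_nonneg hm ?_ ?_) hvi)
    (smul_nonneg (Polynomial.Chebyshev.U_eval_cos_pi_div_nonneg hm ?_ ?_) hvj) <;> split_ifs <;> omega

/-- Every reflection is `w s_i w⁻¹` for some `w` and `i` with `w(e_i)` a positive root. -/
lemma exists_geometricRoot_nonneg (hM : ∀ i j, M i j ≠ 0) (t : cs.Reflections) :
    ∃ w i, 0 ≤ cs.geometricRoot w i ∧ (t : W) = w * cs.simple i * w⁻¹ := by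
  obtain ⟨t, w, i, rfl⟩ := t
  rcases lt_or_gt_of_ne (cs.length_mul_simple_ne w i) with h | h
  · refine ⟨w * cs.simple i, i, cs.geometricRoot_nonneg hM _ _ ?_, ?_⟩
    · rwa [cs.simple_mul_simple_cancel_right]
    · simp [mul_assoc]
  · exact ⟨w, i, cs.geometricRoot_nonneg hM _ _ h, rfl⟩

/-- The positive root of a reflection is unique up to a positive factor, being an eigenvector for
the eigenvalue `-1`. -/
lemma geometricRoot_eq_smul {w w' : W} {i i' : B} (h : 0 ≤ cs.geometricRoot w i)
    (h' : 0 ≤ cs.geometricRoot w' i')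
    (heq : w * cs.simple i * w⁻¹ = w' * cs.simple i' * w'⁻¹) :
    ∃ c : ℝ, 0 < c ∧ cs.geometricRoot w i = c • cs.geometricRoot w' i' := by
  have h1 : cs.geometricRep (w * cs.simple i * w⁻¹) (cs.geometricRoot w i) =
      -cs.geometricRoot w i := by
    rw [geometricRoot, ← LinearEquiv.mul_apply, ← map_mul, inv_mul_cancel_right]
    exact cs.geometricRoot_mul_simple_self w i
  have h2 : ∀ v, ∃ a : ℝ, cs.geometricRep (w' * cs.simple i' * w'⁻¹) v =
      v - a • cs.geometricRoot w' i' := by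
    intro v
    refine ⟨M.geometricCoroot i' (cs.geometricRep w'⁻¹ v), ?_⟩
    rw [map_mul, map_mul, LinearEquiv.mul_apply, LinearEquiv.mul_apply, geometricRep_simple,
      CoxeterMatrix.geometricReflection, Module.reflection_apply, map_sub, map_smul,
      ← LinearEquiv.mul_apply, ← map_mul, mul_inv_cancel, map_one]
    rfl
  obtain ⟨a, ha⟩ := h2 (cs.geometricRoot w i)
  rw [← heq, h1] at ha
  have ha' : cs.geometricRoot w i = (a / 2) • cs.geometricRoot w' i' := by
    have : (2 : ℝ) • cs.geometricRoot w i = a • cs.geometricRoot w' i' := by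
      rw [two_smul]
      nth_rw 1 [← neg_neg (cs.geometricRoot w i)]
      rw [ha]; abel
    rw [div_eq_inv_mul, mul_smul, ← this, smul_smul]
    norm_num
  refine ⟨a / 2, ?_, ha'⟩
  by_contra hneg
  apply cs.geometricRoot_ne_zero w i
  refine le_antisymm ?_ h
  rw [ha']
  exact smul_nonpos_of_nonpos_of_nonneg (not_lt.1 hneg) h'

end CoxeterSystem

/-! ### The oriented matroid of a symmetric vector configuration -/

section ofVectors

variable {E V : Type*} [AddCommGroup V] [Module ℝ V]

open PointedCone

lemma PointedCone.smul_mem_iff_of_pos {C : PointedCone ℝ V} {c : ℝ} (hc : 0 < c) {v : V} :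
    c • v ∈ C ↔ v ∈ C := by
  refine ⟨fun h ↦ ?_, fun h ↦ C.smul_mem hc.le h⟩
  have := C.smul_mem (inv_pos.2 hc).le h
  rwa [inv_smul_smul₀ hc.ne'] at this

/-- Two families of generators that agree up to positive factors span the same cone. -/
lemma PointedCone.hull_le_of_forall_smul_mem {S : Set V} {C : PointedCone ℝ V}
    (h : ∀ v ∈ S, ∃ c : ℝ, 0 < c ∧ c • v ∈ C) : hull ℝ S ≤ C := by
  refine Submodule.span_le.2 fun v hv ↦ ?_
  obtain ⟨c, hc, hcv⟩ := h v hv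
  exact (smul_mem_iff_of_pos hc).1 hcv

/-- A map `r` to a real vector space that turns a fixed-point-free involution into negation defines
an oriented matroid: the closure of `X` consists of the `x` with `r x` in the cone of `r X`. -/
def OrientedMatroid.ofVectors (inv : E → E) (inv_inv : ∀ x, inv (inv x) = x)
    (inv_ne : ∀ x, inv x ≠ x) (r : E → V) (hr : ∀ x, r (inv x) = -r x) : OrientedMatroid E where
  inv := inv
  inv_inv := inv_inv
  inv_ne := inv_ne
  cl := ClosureOperator.mk' (fun X ↦ {x | r x ∈ hull ℝ (r '' X)})
    (fun X Y h x hx ↦ Submodule.span_mono (Set.image_mono h) hx)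
    (fun X x hx ↦ subset_hull (Set.mem_image_of_mem r hx))
    (fun X x hx ↦ by
      refine (Submodule.span_le (p := hull ℝ (r '' X))).2 ?_ hx
      rintro _ ⟨y, hy, rfl⟩
      exact hy)
  finitary X x hx := by
    obtain ⟨T, hT, hxT⟩ := Submodule.mem_span_finite_of_mem_span (R := {c : ℝ // 0 ≤ c}) hx
    obtain ⟨Y, hYX, hY⟩ := (Set.exists_subset_image_finite_and (f := r) (s := X)
      (p := fun S ↦ S = (T : Set V))).1 ⟨T, hT, T.finite_toSet, rfl⟩
    exact ⟨Y, hYX, hY.1, by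
      change r x ∈ hull ℝ (r '' Y)
      rw [hY.2]; exact hxT⟩
  inv_cl X := by
    have hneg : ∀ (Y : Set E) (x : E), r x ∈ hull ℝ (r '' Y) →
        r (inv x) ∈ hull ℝ (r '' (inv '' Y)) := by
      intro Y x hx
      rw [hr]
      have h1 : Submodule.map (-LinearMap.id : V →ₗ[{c : ℝ // 0 ≤ c}] V) (hull ℝ (r '' Y)) =
          hull ℝ (r '' (inv '' Y)) := by
        rw [hull, hull, Submodule.map_span, ← Set.image_comp, ← Set.image_comp]
        congr 1
        refine Set.image_congr fun y _ ↦ ?_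
        simp [hr]
      rw [← h1]
      exact ⟨r x, hx, by simp⟩
    ext x
    constructor
    · rintro ⟨y, hy, rfl⟩
      exact hneg X y hy
    · intro hx
      refine ⟨inv x, ?_, inv_inv x⟩
      have h2 := hneg _ _ hx
      rw [← Set.image_comp inv, show inv ∘ inv = id from funext inv_inv, Set.image_id] at h2
      exact h2
  mem_of_mem_insert_inv X x hx := by
    change r x ∈ hull ℝ (r '' (X ∪ {inv x})) at hx
    change r x ∈ hull ℝ (r '' X)
    rw [Set.union_singleton, Set.image_insert_eq, hr] at hx
    obtain ⟨⟨a, ha⟩, z, hz, h⟩ := Submodule.mem_span_insert.1 hx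
    rw [Nonneg.mk_smul] at h
    rw [← smul_mem_iff_of_pos (by linarith : 0 < 1 + a)]
    have : (1 + a) • r x = z := by
      rw [add_smul, one_smul]
      nth_rw 1 [h]
      module
    rwa [this]
  exchange X x y hx hnx := by
    change r x ∈ hull ℝ (r '' (X ∪ {inv y})) at hx
    change r x ∉ hull ℝ (r '' X) at hnx
    change r y ∈ hull ℝ (r '' ((X \ {y}) ∪ {inv x}))
    rw [Set.union_singleton, Set.image_insert_eq, hr] at hx ⊢
    obtain ⟨⟨c, hc⟩, z, hz, h⟩ := Submodule.mem_span_insert.1 hx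
    -- Separate the contribution of `y` itself to the part of the combination coming from `X`.
    obtain ⟨a, ha, k, hk, hz', hXa⟩ : ∃ a : ℝ, 0 ≤ a ∧ ∃ k ∈ hull ℝ (r '' (X \ {y})),
        z = a • r y + k ∧ ∀ b : ℝ, 0 ≤ b → b ≤ a → k + b • r y ∈ hull ℝ (r '' X) := by
      by_cases hy : y ∈ X
      · rw [← Set.insert_sdiff_self_of_mem hy, Set.image_insert_eq] at hz
        obtain ⟨⟨a, ha⟩, k, hk, h'⟩ := Submodule.mem_span_insert.1 hz
        refine ⟨a, ha, k, hk, h', fun b hb _ ↦ add_mem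
          (Submodule.span_mono (Set.image_mono Set.sdiff_subset) hk)
          (Submodule.smul_mem _ ⟨b, hb⟩ (subset_hull (Set.mem_image_of_mem r hy)))⟩
      · refine ⟨0, le_rfl, z, by rwa [Set.sdiff_singleton_eq_self hy], by simp, fun b hb hb' ↦ ?_⟩
        rw [le_antisymm hb' hb]
        simpa using hz
    rw [Nonneg.mk_smul] at h
    have hlt : a < c := by
      by_contra hcon
      rw [not_lt] at hcon
      refine hnx ?_
      have := hXa (a - c) (by linarith) (by linarith)
      rwa [show k + (a - c) • r y = r x by rw [h, hz']; module] at this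
    rw [← smul_mem_iff_of_pos (by linarith : 0 < c - a),
      show (c - a) • r y = -r x + k by rw [h, hz']; module]
    exact add_mem (subset_hull (Set.mem_insert _ _))
      (Submodule.span_mono (Set.subset_insert _ _) hk)

lemma OrientedMatroid.mem_cl_ofVectors {inv : E → E} {inv_inv : ∀ x, inv (inv x) = x}
    {inv_ne : ∀ x, inv x ≠ x} {r : E → V} {hr : ∀ x, r (inv x) = -r x} {X : Set E} {x : E} :
    x ∈ (ofVectors inv inv_inv inv_ne r hr).cl X ↔ r x ∈ hull ℝ (r '' X) := Iff.rfl

end ofVectors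

/-! ### Comparison of a realization with the geometric representation -/

namespace CoxeterSystem

variable {B W : Type*} [Group W] {M : CoxeterMatrix B} (cs : CoxeterSystem M W)

section

variable (hM : ∀ i j, M i j ≠ 0)

/-- A vector `ε • α` of the geometric representation for each `(t, ε)`, where `α` is a chosen
positive root of the reflection `t`. -/
noncomputable def geometricVector (x : cs.Reflections × ℤˣ) : B →₀ ℝ :=
  (x.2 : ℤ) • cs.geometricRoot (cs.exists_geometricRoot_nonneg hM x.1).choose
    (cs.exists_geometricRoot_nonneg hM x.1).choose_spec.choose

lemma geometricVector_neg (t : cs.Reflections) (ε : ℤˣ) :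
    cs.geometricVector hM (t, -ε) = -cs.geometricVector hM (t, ε) := by
  simp [geometricVector]

/-- The oriented matroid on `T × {±1}` given by the geometric representation. -/
noncomputable def geometricOrientedMatroid : OrientedMatroid (cs.Reflections × ℤˣ) :=
  .ofVectors (fun x ↦ (x.1, -x.2)) (fun x ↦ by simp)
    (fun x h ↦ by
      have h2 : -x.2 = x.2 := congrArg Prod.snd h
      rcases Int.units_eq_one_or x.2 with h1 | h1 <;> rw [h1] at h2 <;> revert h2 <;> decide)
    (cs.geometricVector hM) (fun x ↦ cs.geometricVector_neg hM x.1 x.2)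

end

namespace Realization

variable {cs} {V Vd : Type*} [AddCommGroup V] [Module ℝ V] [AddCommGroup Vd] [Module ℝ Vd]

/-- Rescaling the simple roots of `D` by the positive factors `k` turns its Cartan matrix into
the symmetric matrix with entries `-2 cos(π / m_ij)`. -/
structure IsNormalizedBy (D : cs.Realization V Vd) (k : B → ℝ) : Prop where
  pos : ∀ i, 0 < k i
  pairing_mul : ∀ i j, D.pairing (D.root i) (D.coroot j) * k i =
    -(2 * Real.cos (Real.pi / M i j)) * k j

lemma equiv_simple_apply (D : cs.Realization V Vd) (i : B) (v : V) :
    (D.equiv (cs.simple i) : V ≃ₗ[ℝ] V) v = v - D.pairing v (D.coroot i) • D.root i := by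
  rw [D.equiv_simple]
  exact Module.reflection_apply (f := D.pairing.flip (D.coroot i)) v (D.pairing_self i)

section

variable {D : cs.Realization V Vd} {k : B → ℝ}

/-- The linear map sending the basis vectors of the geometric representation to the rescaled
simple roots is equivariant. -/
lemma IsNormalizedBy.linearCombination_geometricRep (h : D.IsNormalizedBy k) (w : W) (v : B →₀ ℝ) :
    Finsupp.linearCombination ℝ (fun i ↦ k i • D.root i) (cs.geometricRep w v) =
      (D.equiv w : V ≃ₗ[ℝ] V) (Finsupp.linearCombination ℝ (fun i ↦ k i • D.root i) v) := by
  induction w using cs.simple_induction_left generalizing v with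
  | one => simp
  | mul_simple_left w j ih =>
    rw [map_mul, map_mul, Subgroup.coe_mul, LinearEquiv.mul_apply, LinearEquiv.mul_apply, ← ih,
      cs.geometricRep_simple]
    generalize cs.geometricRep w v = u
    induction u using Finsupp.induction_linear with
    | zero => simp
    | add f g hf hg => rw [map_add, map_add, hf, hg, map_add, map_add]
    | single i a =>
      rw [← mul_one a, ← smul_eq_mul, ← Finsupp.smul_single, map_smul, map_smul, map_smul, map_smul,
        M.geometricReflection_single, map_add, map_smul, Finsupp.linearCombination_single,
        Finsupp.linearCombination_single, equiv_simple_apply, one_smul, one_smul, map_smul,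
        LinearMap.smul_apply, smul_eq_mul, mul_comm (k i), h.pairing_mul]
      module

lemma IsNormalizedBy.linearCombination_geometricRoot (h : D.IsNormalizedBy k) (w : W) (i : B) :
    Finsupp.linearCombination ℝ (fun i ↦ k i • D.root i) (cs.geometricRoot w i) =
      k i • D.rootAt w i := by
  rw [geometricRoot, h.linearCombination_geometricRep, Finsupp.linearCombination_single, one_smul,
    map_smul, rootAt]

lemma IsNormalizedBy.linearCombination_injective (h : D.IsNormalizedBy k)
    (hli : LinearIndependent ℝ D.root) :
    Function.Injective (Finsupp.linearCombination ℝ (fun i ↦ k i • D.root i)) :=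
  hli.units_smul (fun i ↦ Units.mk0 (k i) (h.pos i).ne')

lemma IsNormalizedBy.linearCombination_mem_hull_iff (h : D.IsNormalizedBy k)
    (hli : LinearIndependent ℝ D.root) (v : B →₀ ℝ) :
    Finsupp.linearCombination ℝ (fun i ↦ k i • D.root i) v ∈
      PointedCone.hull ℝ (Set.range D.root) ↔ 0 ≤ v := by
  constructor
  · intro hv
    have key : ∀ u ∈ PointedCone.hull ℝ (Set.range D.root), ∃ v : B →₀ ℝ, 0 ≤ v ∧
        Finsupp.linearCombination ℝ (fun i ↦ k i • D.root i) v = u := by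
      intro u hu
      induction hu using Submodule.span_induction with
      | mem x hx =>
        obtain ⟨i, rfl⟩ := hx
        refine ⟨Finsupp.single i (k i)⁻¹, Finsupp.single_nonneg.2 (inv_pos.2 (h.pos i)).le, ?_⟩
        rw [Finsupp.linearCombination_single, inv_smul_smul₀ (h.pos i).ne']
      | zero => exact ⟨0, le_rfl, map_zero _⟩
      | add x y _ _ hx hy =>
        obtain ⟨v, hv, rfl⟩ := hx
        obtain ⟨w, hw, rfl⟩ := hy
        exact ⟨v + w, add_nonneg hv hw, map_add _ _ _⟩
      | smul a x _ hx =>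
        obtain ⟨v, hv, rfl⟩ := hx
        exact ⟨(a : ℝ) • v, smul_nonneg a.2 hv, map_smul _ _ _⟩
    obtain ⟨v', hv', he⟩ := key _ hv
    rwa [← h.linearCombination_injective hli he]
  · intro hv
    rw [Finsupp.linearCombination_apply]
    refine Submodule.sum_mem _ fun i _ ↦ ?_
    exact PointedCone.smul_mem _ (hv i) (PointedCone.smul_mem _ (h.pos i).le
      (PointedCone.subset_hull (Set.mem_range_self i)))

lemma IsNormalizedBy.rootAt_mem_posRoots_iff (h : D.IsNormalizedBy k)
    (hli : LinearIndependent ℝ D.root) (w : W) (i : B) :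
    D.rootAt w i ∈ D.posRoots ↔ 0 ≤ cs.geometricRoot w i := by
  rw [← h.linearCombination_mem_hull_iff hli, h.linearCombination_geometricRoot,
    PointedCone.smul_mem_iff_of_pos (h.pos i), posRoots, Set.mem_inter_iff,
    and_iff_right ⟨w, i, rfl⟩, SetLike.mem_coe]

/-- The roots over `(t, ε)` are positive multiples of the vector chosen for `(t, ε)`. -/
lemma IsNormalizedBy.exists_eq_smul_of_proj (h : D.IsNormalizedBy k)
    (hli : LinearIndependent ℝ D.root) (hM : ∀ i j, M i j ≠ 0) {β : V}
    {x : cs.Reflections × ℤˣ} (hx : D.Proj β x) :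
    ∃ c : ℝ, 0 < c ∧
      c • β = Finsupp.linearCombination ℝ (fun i ↦ k i • D.root i) (cs.geometricVector hM x) := by
  obtain ⟨w, i, hpos, hx1, rfl⟩ := hx
  rw [h.rootAt_mem_posRoots_iff hli] at hpos
  obtain ⟨hpos', hx1'⟩ := (cs.exists_geometricRoot_nonneg hM x.1).choose_spec.choose_spec
  obtain ⟨c, hc, he⟩ := cs.geometricRoot_eq_smul hpos' hpos (hx1'.symm.trans hx1)
  refine ⟨c * k i, mul_pos hc (h.pos i), ?_⟩
  rw [geometricVector, he, map_zsmul, map_smul, h.linearCombination_geometricRoot,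
    smul_comm, mul_smul]

lemma IsNormalizedBy.exists_proj (h : D.IsNormalizedBy k) (hli : LinearIndependent ℝ D.root)
    (hM : ∀ i j, M i j ≠ 0) (x : cs.Reflections × ℤˣ) : ∃ β ∈ D.roots, D.Proj β x := by
  obtain ⟨w, i, hpos, hx1⟩ := cs.exists_geometricRoot_nonneg hM x.1
  refine ⟨(x.2 : ℤ) • D.rootAt w i, ?_, w, i, (h.rootAt_mem_posRoots_iff hli w i).2 hpos, hx1, rfl⟩
  rcases Int.units_eq_one_or x.2 with h1 | h1
  · exact ⟨w, i, by simp [h1]⟩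
  · refine ⟨w * cs.simple i, i, ?_⟩
    rw [rootAt, rootAt, map_mul, Subgroup.coe_mul, LinearEquiv.mul_apply, equiv_simple_apply,
      D.pairing_self, h1, map_sub, map_smul]
    simp only [Units.val_neg, Units.val_one, Int.reduceNeg, neg_smul, one_smul]
    module

/-- A normalized realization with linearly independent simple roots gives the same oriented matroid
as the geometric representation. -/
theorem IsNormalizedBy.induces (h : D.IsNormalizedBy k) (hli : LinearIndependent ℝ D.root)
    (hM : ∀ i j, M i j ≠ 0) : D.Induces (cs.geometricOrientedMatroid hM) := by
  refine ⟨fun t ε ↦ rfl, fun A ↦ ?_⟩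
  set φ := Finsupp.linearCombination ℝ (fun i ↦ k i • D.root i) with hφ
  have hφinj : Function.Injective φ := h.linearCombination_injective hli
  have hhull : PointedCone.hull ℝ (D.preimage A) =
      PointedCone.hull ℝ (φ '' (cs.geometricVector hM '' A)) := by
    apply le_antisymm
    · refine PointedCone.hull_le_of_forall_smul_mem ?_
      rintro β ⟨x, hx, hβ⟩
      obtain ⟨c, hc, he⟩ := h.exists_eq_smul_of_proj hli hM hβ
      exact ⟨c, hc, by
        rw [he]
        exact PointedCone.subset_hull (Set.mem_image_of_mem _ (Set.mem_image_of_mem _ hx))⟩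
    · refine PointedCone.hull_le_of_forall_smul_mem ?_
      rintro _ ⟨_, ⟨x, hx, rfl⟩, rfl⟩
      obtain ⟨β, -, hβ⟩ := h.exists_proj hli hM x
      obtain ⟨c, hc, he⟩ := h.exists_eq_smul_of_proj hli hM hβ
      exact ⟨1, one_pos, by
        rw [one_smul, hφ, ← he]
        exact PointedCone.smul_mem _ hc.le (PointedCone.subset_hull ⟨x, hx, hβ⟩)⟩
  have hmap : ∀ v, φ v ∈ PointedCone.hull ℝ (φ '' (cs.geometricVector hM '' A)) ↔
      v ∈ PointedCone.hull ℝ (cs.geometricVector hM '' A) := by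
    intro v
    have : PointedCone.hull ℝ (φ '' (cs.geometricVector hM '' A)) =
        Submodule.map (φ.restrictScalars {c : ℝ // 0 ≤ c})
          (PointedCone.hull ℝ (cs.geometricVector hM '' A)) := by
      rw [PointedCone.hull, PointedCone.hull, Submodule.map_span]
      rfl
    rw [this]
    exact hφinj.mem_set_image
  ext x
  rw [geometricOrientedMatroid, OrientedMatroid.mem_cl_ofVectors, ← hmap, ← hhull]
  constructor
  · intro hx
    obtain ⟨β, hβ, hβx⟩ := h.exists_proj hli hM x
    obtain ⟨c, hc, he⟩ := h.exists_eq_smul_of_proj hli hM hβx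
    exact ⟨β, ⟨(PointedCone.smul_mem_iff_of_pos hc).1 (by rw [he]; exact hx), hβ⟩, hβx⟩
  · rintro ⟨β, ⟨hβ, -⟩, hβx⟩
    obtain ⟨c, hc, he⟩ := h.exists_eq_smul_of_proj hli hM hβx
    rw [hφ, ← he]
    exact PointedCone.smul_mem _ hc.le hβ

end

end Realization

end CoxeterSystem

/-! ### Cartan matrices of realizations -/

lemma PositivelyIndependent.smul_add_smul_ne_zero {ι V : Type*} [AddCommGroup V] [Module ℝ V]
    {v : ι → V} (h : PositivelyIndependent v) {i j : ι} (hij : i ≠ j) {p q : ℝ} (hp : 0 < p)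
    (hq : 0 < q) : p • v i + q • v j ≠ 0 := by
  classical
  have := h {i, j} (fun l ↦ if l = i then p else q) (by simp)
    (fun l _ ↦ by split_ifs <;> assumption)
  rwa [Finset.sum_pair hij, if_pos rfl, if_neg hij.symm] at this

namespace CoxeterSystem.Realization

variable {B W : Type*} [Group W] {M : CoxeterMatrix B} {cs : CoxeterSystem M W}
  {V Vd : Type*} [AddCommGroup V] [Module ℝ V] [AddCommGroup Vd] [Module ℝ Vd]

lemma orderOf_simpleReflection_mul (D : cs.Realization V Vd) (i j : B) :
    orderOf (D.simpleReflection i * D.simpleReflection j) = M i j := by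
  rw [← cs.orderOf_simple_mul_simple i j, ← D.equiv_simple, ← D.equiv_simple, ← Subgroup.coe_mul,
    ← map_mul, Subgroup.orderOf_coe]
  exact orderOf_injective D.equiv.toMonoidHom D.equiv.injective _

/-- For finite labels the product of the two Cartan integers is forced by the group, since
otherwise `s_i s_j` would have the wrong order. -/
lemma pairing_mul_pairing_eq (D : cs.Realization V Vd) {i j : B} (hij : i ≠ j) (h0 : M i j ≠ 0) :
    D.pairing (D.root i) (D.coroot j) * D.pairing (D.root j) (D.coroot i) =
      4 * Real.cos (Real.pi / M i j) ^ 2 := by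
  have hord := D.orderOf_simpleReflection_mul i j
  have hzero := (D.pairing_eq_zero_iff i j hij).symm
  rcases D.pairing_mul_pairing i j hij with ⟨m, hm, h⟩ | h
  · rw [mul_comm] at h
    have := Module.orderOf_reflection_mul_reflection (V := V)
      (f := D.pairing.flip (D.coroot i)) (g := D.pairing.flip (D.coroot j)) hm
      (D.pairing_self i) (D.pairing_self j) (D.pairing_nonpos j i hij.symm)
      (D.pairing_nonpos i j hij) hzero h
    have hmM : M i j = m := hord.symm.trans this
    rw [hmM, ← h, mul_comm]
  · rw [mul_comm] at h
    refine absurd ?_ (Module.reflection_mul_reflection_pow_ne_one (V := V)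
      (f := D.pairing.flip (D.coroot i)) (g := D.pairing.flip (D.coroot j))
      (D.pairing_self i) (D.pairing_self j) (D.pairing_nonpos j i hij.symm)
      (D.pairing_nonpos i j hij) h
      (fun p q hp hq ↦ D.root_posIndep.smul_add_smul_ne_zero hij hp hq) h0)
    rw [← hord]
    exact pow_orderOf_eq_one _

end CoxeterSystem.Realization

/-! ### Realizations of finite Coxeter groups -/

section

variable {V : Type*} [AddCommGroup V] [Module ℝ V]

/-- Averaging over a finite group produces an invariant inner product, in any dimension. -/
lemma exists_invariant_posDef_form {G : Type*} [Group G] [Finite G] (ρ : G →* (V ≃ₗ[ℝ] V)) :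
    ∃ Q : V →ₗ[ℝ] V →ₗ[ℝ] ℝ, (∀ v w, Q v w = Q w v) ∧ (∀ v, v ≠ 0 → 0 < Q v v) ∧
      ∀ g v w, Q (ρ g v) (ρ g w) = Q v w := by
  classical
  have := Fintype.ofFinite G
  let b := Module.Basis.ofVectorSpace ℝ V
  have hsymm : ∀ v w, b.toDual v w = b.toDual w v := by
    have : b.toDual = b.toDual.flip := by
      refine b.ext fun i ↦ b.ext fun j ↦ ?_
      rw [LinearMap.flip_apply, b.toDual_apply, b.toDual_apply]
      simp only [eq_comm]
    intro v w
    nth_rw 1 [this]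
    rfl
  have hself : ∀ v, b.toDual v v = ∑ i ∈ (b.repr v).support, b.repr v i ^ 2 := by
    intro v
    nth_rw 1 [← b.linearCombination_repr v]
    rw [Finsupp.linearCombination_apply, Finsupp.sum, map_sum, LinearMap.sum_apply]
    refine Finset.sum_congr rfl fun i _ ↦ ?_
    rw [map_smul, LinearMap.smul_apply, b.toDual_apply_right, smul_eq_mul, sq]
  have hpos : ∀ v, v ≠ 0 → 0 < b.toDual v v := by
    intro v hv
    rw [hself]
    refine Finset.sum_pos (fun i hi ↦ ?_) ?_
    · have := Finsupp.mem_support_iff.1 hi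
      positivity
    · rwa [Finsupp.support_nonempty_iff, Ne, LinearEquiv.map_eq_zero_iff]
  refine ⟨∑ g : G, (b.toDual).compl₁₂ (ρ g : V →ₗ[ℝ] V) (ρ g : V →ₗ[ℝ] V), ?_, ?_, ?_⟩
  · intro v w
    simp only [LinearMap.sum_apply, LinearMap.compl₁₂_apply]
    exact Finset.sum_congr rfl fun g _ ↦ hsymm _ _
  · intro v hv
    simp only [LinearMap.sum_apply, LinearMap.compl₁₂_apply]
    refine Finset.sum_pos (fun g _ ↦ hpos _ ?_) ⟨1, Finset.mem_univ _⟩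
    simpa using hv
  · intro h v w
    simp only [LinearMap.sum_apply, LinearMap.compl₁₂_apply]
    refine Fintype.sum_equiv (Equiv.mulRight h) _ _ fun g ↦ ?_
    simp

/-- Pairwise obtuse positively independent vectors are linearly independent: in a relation, the
sum of the terms with positive coefficients has nonpositive inner product with itself. -/
lemma linearIndependent_of_obtuse {ι : Type*} {v : ι → V} {Q : V →ₗ[ℝ] V →ₗ[ℝ] ℝ}
    (hQ : ∀ v, v ≠ 0 → 0 < Q v v) (hv : ∀ i j, i ≠ j → Q (v i) (v j) ≤ 0)
    (hpi : PositivelyIndependent v) : LinearIndependent ℝ v := by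
  classical
  rw [linearIndependent_iff']
  intro s c hc
  set P := s.filter (fun i ↦ 0 < c i) with hP
  set N := s.filter (fun i ↦ c i < 0) with hN
  have hsum : ∑ i ∈ P, c i • v i = ∑ i ∈ N, (-c i) • v i := by
    have h1 : ∑ i ∈ P, c i • v i + ∑ i ∈ N, c i • v i = 0 := by
      rw [← hc, hP, hN, Finset.sum_filter, Finset.sum_filter, ← Finset.sum_add_distrib]
      refine Finset.sum_congr rfl fun i _ ↦ ?_
      rcases lt_trichotomy (c i) 0 with h | h | h
      · simp [h, h.not_gt]
      · simp [h]
      · simp [h, h.not_gt]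
    simp only [neg_smul, Finset.sum_neg_distrib]
    exact eq_neg_of_add_eq_zero_left h1
  have hle : Q (∑ i ∈ P, c i • v i) (∑ i ∈ P, c i • v i) ≤ 0 := by
    nth_rw 2 [hsum]
    simp only [map_sum, LinearMap.sum_apply, map_smul, LinearMap.smul_apply, smul_eq_mul]
    refine Finset.sum_nonpos fun i hi ↦ mul_nonpos_of_nonneg_of_nonpos
      (neg_pos.2 (Finset.mem_filter.1 hi).2).le (Finset.sum_nonpos fun j hj ↦ ?_)
    refine mul_nonpos_of_nonneg_of_nonpos (Finset.mem_filter.1 hj).2.le (hv j i ?_)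
    rintro rfl
    exact absurd (Finset.mem_filter.1 hi).2 (Finset.mem_filter.1 hj).2.not_gt
  have hzero : ∑ i ∈ P, c i • v i = 0 := by
    by_contra hne
    exact absurd (hQ _ hne) (not_lt.2 hle)
  have hPe : P = ∅ := by
    by_contra hne
    exact hpi P c (Finset.nonempty_iff_ne_empty.2 hne) (fun i hi ↦ (Finset.mem_filter.1 hi).2) hzero
  have hNe : N = ∅ := by
    by_contra hne
    exact hpi N (fun i ↦ -c i) (Finset.nonempty_iff_ne_empty.2 hne)
      (fun i hi ↦ neg_pos.2 (Finset.mem_filter.1 hi).2) (hsum ▸ hzero)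
  intro i hi
  by_contra hne
  rcases lt_or_gt_of_ne hne with h | h
  · exact Finset.notMem_empty i (hNe ▸ Finset.mem_filter.2 ⟨hi, h⟩)
  · exact Finset.notMem_empty i (hPe ▸ Finset.mem_filter.2 ⟨hi, h⟩)

/-- The inner product `q` of two vectors of lengths `n` and `n'` is recovered from the product of
the two Cartan integers `2 q / n'²` and `2 q / n²`. -/
lemma eq_neg_mul_of_pairing_mul_pairing {a a' q n n' c : ℝ} (h : a * n' ^ 2 = 2 * q)
    (h' : a' * n ^ 2 = 2 * q) (haa : a * a' = 4 * c ^ 2) (hq : q ≤ 0) (hc : 0 ≤ c) (hn : 0 < n)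
    (hn' : 0 < n') : q = -(c * (n * n')) := by
  have h1 : -q = c * (n * n') := by
    refine (sq_eq_sq₀ (by linarith) (by positivity)).1 ?_
    have : (2 * q) * (2 * q) = (a * a') * (n * n') ^ 2 := by
      nth_rw 1 [← h]
      rw [← h']; ring
    rw [haa] at this
    nlinarith
  linarith

end

namespace CoxeterSystem

variable {B W : Type*} [Group W] {M : CoxeterMatrix B}

lemma label_ne_zero_of_finite (cs : CoxeterSystem M W) [Finite W] (i j : B) : M i j ≠ 0 := by
  rw [← cs.orderOf_simple_mul_simple i j]
  exact (orderOf_pos _).ne'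

variable {cs : CoxeterSystem M W} {V Vd : Type*} [AddCommGroup V] [Module ℝ V] [AddCommGroup Vd] [Module ℝ Vd]

/-- For a finite group, the reflections are orthogonal for an invariant inner product, and
normalizing amounts to passing to unit vectors. -/
lemma Realization.exists_isNormalizedBy_of_finite [Finite W] (D : cs.Realization V Vd) :
    LinearIndependent ℝ D.root ∧ ∃ k, D.IsNormalizedBy k := by
  obtain ⟨Q, hsymm, hpos, hinv⟩ :=
    exists_invariant_posDef_form ((D.reflectionGroup.subtype).comp D.equiv.toMonoidHom)
  have hne : ∀ i, D.root i ≠ 0 := fun i h ↦ by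
    have := D.pairing_self i
    rw [h, map_zero, LinearMap.zero_apply] at this
    norm_num at this
  have hQ : ∀ i v, D.pairing v (D.coroot i) * Q (D.root i) (D.root i) = 2 * Q v (D.root i) := by
    intro i v
    have h1 := hinv (cs.simple i) v (D.root i)
    change Q ((D.equiv (cs.simple i) : V ≃ₗ[ℝ] V) v)
      ((D.equiv (cs.simple i) : V ≃ₗ[ℝ] V) (D.root i)) = _ at h1
    rw [D.equiv_simple_apply, D.equiv_simple_apply, D.pairing_self] at h1
    simp only [map_sub, map_smul, LinearMap.sub_apply, LinearMap.smul_apply, smul_eq_mul] at h1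
    linarith
  have hQpos : ∀ i, 0 < Q (D.root i) (D.root i) := fun i ↦ hpos _ (hne i)
  have hobt : ∀ i j, i ≠ j → Q (D.root i) (D.root j) ≤ 0 := by
    intro i j hij
    have h1 := hQ j (D.root i)
    have h2 := mul_nonpos_of_nonpos_of_nonneg (D.pairing_nonpos i j hij) (hQpos j).le
    linarith
  refine ⟨linearIndependent_of_obtuse hpos hobt D.root_posIndep,
    fun i ↦ (√(Q (D.root i) (D.root i)))⁻¹, fun i ↦ inv_pos.2 (Real.sqrt_pos.2 (hQpos i)), ?_⟩
  intro i j
  have hni := Real.sqrt_pos.2 (hQpos i)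
  have hnj := Real.sqrt_pos.2 (hQpos j)
  have hqi := Real.sq_sqrt (hQpos i).le
  have hqj := Real.sq_sqrt (hQpos j).le
  set ni := √(Q (D.root i) (D.root i))
  set nj := √(Q (D.root j) (D.root j))
  rw [← div_eq_mul_inv, ← div_eq_mul_inv, div_eq_div_iff hni.ne' hnj.ne']
  rcases eq_or_ne i j with rfl | hij
  · rw [D.pairing_self, M.diagonal]
    simp [ni, nj]
  have hM := cs.label_ne_zero_of_finite i j
  have h1 := hQ j (D.root i)
  have h2 := hQ i (D.root j)
  have h3 := D.pairing_mul_pairing_eq hij hM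
  have h4 := hobt i j hij
  have hcos := Real.cos_pi_div_natCast_nonneg (M.two_le_of_ne hij hM)
  rw [hsymm (D.root j) (D.root i), ← hqi] at h2
  rw [← hqj] at h1
  set a := D.pairing (D.root i) (D.coroot j)
  set a' := D.pairing (D.root j) (D.coroot i)
  set q := Q (D.root i) (D.root j)
  set c := Real.cos (Real.pi / M i j)
  have h5 := eq_neg_mul_of_pairing_mul_pairing h1 h2 h3 h4 hcos hni hnj
  refine mul_right_cancel₀ hnj.ne' ?_
  linear_combination h1 + 2 * h5

end CoxeterSystem

/-! ### Cycles and potentials in Coxeter graphs -/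

/-- On an acyclic graph every multiplicative cocycle on the edges comes from a potential on the
vertices: remove an edge, and rescale on one side of this bridge. -/
lemma SimpleGraph.IsAcyclic.exists_potential {B : Type*} [Finite B] {G : SimpleGraph B}
    (hG : G.IsAcyclic) (r : B → B → ℝ) (hr : ∀ i j, G.Adj i j → 0 < r i j)
    (hr' : ∀ i j, G.Adj i j → r i j * r j i = 1) :
    ∃ k : B → ℝ, (∀ i, 0 < k i) ∧ ∀ i j, G.Adj i j → k j = r i j * k i := by
  classical
  induction hn : G.edgeSet.ncard using Nat.strong_induction_on generalizing G with
  | _ n ih =>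
  by_cases hedge : ∃ a b, G.Adj a b
  · obtain ⟨a, b, hab⟩ := hedge
    have hbr := (isAcyclic_iff_forall_adj_isBridge.1 hG) hab
    rw [isBridge_iff] at hbr
    set G' := G.deleteEdges {s(a, b)} with hG'
    have hle : G' ≤ G := deleteEdges_le _
    have hlt : G'.edgeSet.ncard < n := by
      rw [← hn]
      refine Set.ncard_lt_ncard ⟨edgeSet_mono hle, fun h ↦ ?_⟩ (Set.toFinite _)
      have : s(a, b) ∈ G'.edgeSet := h hab
      simp [hG'] at this
    obtain ⟨k, hk, hkr⟩ := ih _ hlt (hG.anti hle) (fun i j h ↦ hr i j (hle h))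
      (fun i j h ↦ hr' i j (hle h)) rfl
    set t := r a b * k a / k b with ht
    have htpos : 0 < t := div_pos (mul_pos (hr a b hab) (hk a)) (hk b)
    have htk : t * k b = r a b * k a := by rw [ht, div_mul_cancel₀ _ (hk b).ne']
    refine ⟨fun i ↦ if G'.Reachable b i then t * k i else k i, fun i ↦ ?_, fun i j hij ↦ ?_⟩
    · dsimp only
      split_ifs
      · exact mul_pos htpos (hk i)
      · exact hk i
    · have hba : ¬ G'.Reachable b a := fun h ↦ hbr h.symm
      by_cases he : s(i, j) = s(a, b)
      · rcases Sym2.eq_iff.1 he with ⟨rfl, rfl⟩ | ⟨rfl, rfl⟩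
        · simp only [if_pos (Reachable.refl _), if_neg hba, htk]
        · simp only [if_pos (Reachable.refl _), if_neg hba, htk]
          rw [← mul_assoc, hr' i j hij, one_mul]
      · have hadj : G'.Adj i j := by
          rw [hG', deleteEdges_adj]
          exact ⟨hij, he⟩
        have hiff : G'.Reachable b i ↔ G'.Reachable b j :=
          ⟨fun h ↦ h.trans hadj.reachable, fun h ↦ h.trans hadj.symm.reachable⟩
        simp only [hiff]
        split_ifs
        · rw [hkr i j hadj]; ring
        · exact hkr i j hadj
  · push Not at hedge
    exact ⟨fun _ ↦ 1, fun _ ↦ one_pos, fun i j h ↦ absurd h (hedge i j)⟩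

/-- The vertices of a cycle, indexed by integers modulo its length. -/
lemma SimpleGraph.exists_cycle_of_not_isAcyclic {B : Type*} {G : SimpleGraph B}
    (hG : ¬ G.IsAcyclic) :
    ∃ n : ℕ, 2 ≤ n ∧ ∃ f : ZMod (n + 1) → B, Function.Injective f ∧ ∀ t, G.Adj (f t) (f (t + 1)) := by
  unfold IsAcyclic at hG
  push Not at hG
  obtain ⟨v, c, hc⟩ := hG
  have h3 := hc.three_le_length
  obtain ⟨n, hn⟩ : ∃ n, c.length = n + 1 := ⟨c.length - 1, by omega⟩
  refine ⟨n, by omega, fun t ↦ c.getVert t.val, fun s t h ↦ ?_, fun t ↦ ?_⟩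
  · refine ZMod.val_injective _ (hc.getVert_injOn' ?_ ?_ h)
    · have := ZMod.val_lt s
      simp only [Set.mem_ofPred_eq]; omega
    · have := ZMod.val_lt t
      simp only [Set.mem_ofPred_eq]; omega
  · have hlt := ZMod.val_lt t
    have hadj := c.adj_getVert_succ (i := t.val) (by omega)
    have h1 : (t + 1).val = (t.val + 1) % (n + 1) := by
      rw [ZMod.val_add, ZMod.val_one_eq_one_mod, Nat.add_mod_mod]
    dsimp only
    rw [h1]
    rcases (Nat.lt_succ_iff_lt_or_eq.1 hlt) with h2 | h2
    · rwa [Nat.mod_eq_of_lt (by omega)]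
    · rw [h2, Nat.mod_self, c.getVert_zero]
      rwa [h2, ← hn, c.getVert_length] at hadj

namespace CoxeterMatrix

variable {B : Type*} (M : CoxeterMatrix B)

/-- The Coxeter graph, without its labels. -/
def coxeterGraph : SimpleGraph B where
  Adj i j := i ≠ j ∧ M i j ≠ 2
  symm := ⟨fun i j h ↦ ⟨h.1.symm, by rw [M.symmetric]; exact h.2⟩⟩
  loopless := ⟨fun _ h ↦ h.1 rfl⟩

/-- The symmetric matrix with entries `-cos(π / m_ij)`. -/
noncomputable def cosineMatrix (i j : B) : ℝ := -Real.cos (Real.pi / M i j)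

lemma cosineMatrix_self (i : B) : M.cosineMatrix i i = 1 := by
  simp [cosineMatrix]

lemma cosineMatrix_nonpos {i j : B} (hij : i ≠ j) (h0 : M i j ≠ 0) : M.cosineMatrix i j ≤ 0 :=
  neg_nonpos.2 (Real.cos_pi_div_natCast_nonneg (M.two_le_of_ne hij h0))

/-- The labels are finite, and the matrix `(-cos(π / m_ij))` is positive semidefinite with its
kernel spanned by a vector with positive entries. This is the part of the geometry of an irreducible
affine Weyl group that matters for its realizations. -/
structure IsAffine [Fintype B] : Prop where
  label_ne_zero : ∀ i j, M i j ≠ 0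
  nonneg : ∀ x : B → ℝ, 0 ≤ ∑ i, ∑ j, x i * x j * M.cosineMatrix i j
  exists_ker : ∃ δ : B → ℝ, (∀ i, 0 < δ i) ∧ ∀ x : B → ℝ,
    ∑ i, ∑ j, x i * x j * M.cosineMatrix i j = 0 → ∃ a : ℝ, ∀ i, x i = a * δ i

lemma cosineMatrix_le_of_adj {i j : B} (h : M.coxeterGraph.Adj i j) (h0 : M i j ≠ 0) :
    M.cosineMatrix i j ≤ -(1 / 2) := by
  have h3 : (3 : ℝ) ≤ M i j := by
    have := M.two_le_of_ne h.1 h0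
    have := h.2
    exact_mod_cast (by omega : 3 ≤ M i j)
  rw [cosineMatrix, ← Real.cos_pi_div_three]
  refine neg_le_neg (Real.cos_le_cos_of_nonneg_of_le_pi (by positivity) ?_ ?_)
  · linarith [Real.pi_pos]
  · gcongr

/-- The indicator vector of a cycle is isotropic for the matrix `(-cos(π / m_ij))`. By positivity of
the kernel vector the cycle passes through all vertices, and has no larger labels and no chords. -/
lemma IsAffine.isAcyclic {M : CoxeterMatrix B} [Fintype B] (hM : M.IsAffine) (hA : ¬ M.IsTypeATilde) :
    M.coxeterGraph.IsAcyclic := by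
  classical
  by_contra hcyc
  obtain ⟨n, hn, f, hf, hadj⟩ := SimpleGraph.exists_cycle_of_not_isAcyclic hcyc
  refine hA ⟨n, by omega, ?_⟩
  have h01 : (1 : ZMod (n + 1)) ≠ 0 := by
    have : Fact (1 < n + 1) := ⟨by omega⟩
    exact one_ne_zero
  have h11 : (1 : ZMod (n + 1)) + 1 ≠ 0 := by
    intro h
    have h2 : ((2 : ℕ) : ZMod (n + 1)) = 0 := by
      push_cast
      rw [← h]; norm_num
    rw [ZMod.natCast_eq_zero_iff] at h2
    exact absurd (Nat.le_of_dvd (by norm_num) h2) (by omega)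
  let g : ZMod (n + 1) → ZMod (n + 1) → ℝ := fun s t ↦
    (if t = s then 1 else 0) + (if t = s + 1 then -(1 / 2) else 0) +
      (if t = s - 1 then -(1 / 2) else 0)
  have hgsum : ∀ s, ∑ t, g s t = 0 := by
    intro s
    simp only [g, Finset.sum_add_distrib, Finset.sum_ite_eq', Finset.mem_univ, if_true]
    norm_num
  have hg1 : ∀ s, g s s = 1 := by
    intro s
    have h1 : s ≠ s + 1 := fun h ↦ h01 (by simpa using h)
    have h2 : s ≠ s - 1 := fun h ↦ h01 (by simpa [eq_sub_iff_add_eq] using h)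
    simp only [g, if_true]
    rw [if_neg h1, if_neg h2]
    norm_num
  have hg2 : ∀ s t, (t = s + 1 ∨ s = t + 1) → g s t = -(1 / 2) := by
    rintro s t (rfl | rfl)
    · have h1 : s + 1 ≠ s := fun h ↦ h01 (by simpa using h)
      have h2 : s + 1 ≠ s - 1 := fun h ↦ h11 (by
        rw [eq_sub_iff_add_eq, add_assoc] at h
        simpa using h)
      simp only [g, if_true]
      rw [if_neg h1, if_neg h2]
      norm_num
    · have h1 : t ≠ t + 1 := fun h ↦ h01 (by simpa using h)
      have h2 : t ≠ t + 1 + 1 := fun h ↦ h11 (by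
        rw [add_assoc] at h
        simpa using h)
      simp only [g]
      rw [if_neg h1, if_neg h2, if_pos (by ring)]
      norm_num
  have hg3 : ∀ s t, t ≠ s → ¬ (t = s + 1 ∨ s = t + 1) → g s t = 0 := by
    intro s t h1 h2
    push Not at h2
    have h3 : t ≠ s - 1 := fun h ↦ h2.2 (by rw [h]; ring)
    simp only [g]
    rw [if_neg h1, if_neg h2.1, if_neg h3]
    norm_num
  have hle : ∀ s t, M.cosineMatrix (f s) (f t) ≤ g s t := by
    intro s t
    by_cases h1 : t = s
    · rw [h1, hg1, cosineMatrix_self]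
    by_cases h2 : t = s + 1 ∨ s = t + 1
    · rw [hg2 s t h2]
      refine M.cosineMatrix_le_of_adj ?_ (hM.label_ne_zero _ _)
      rcases h2 with rfl | rfl
      · exact hadj s
      · exact (hadj t).symm
    · rw [hg3 s t h1 h2]
      exact M.cosineMatrix_nonpos (fun h ↦ h1 (hf h).symm) (hM.label_ne_zero _ _)
  let x : B → ℝ := fun i ↦ if i ∈ Set.range f then 1 else 0
  have hpull : ∀ F : B → ℝ, ∑ i, x i * F i = ∑ t, F (f t) := by
    intro F
    rw [← Finset.sum_image (f := F) (s := Finset.univ) (g := f) (fun a _ b _ h ↦ hf h)]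
    simp only [x, ite_mul, one_mul, zero_mul]
    rw [← Finset.sum_filter]
    congr 1
    ext i
    simp
  have hsum : ∑ i, ∑ j, x i * x j * M.cosineMatrix i j =
      ∑ s, ∑ t, M.cosineMatrix (f s) (f t) := by
    simp only [mul_assoc, ← Finset.mul_sum]
    rw [hpull]
    exact Finset.sum_congr rfl fun s _ ↦ hpull _
  have hgtot : ∑ s, ∑ t, g s t = 0 := Finset.sum_eq_zero fun s _ ↦ hgsum s
  have hle' : ∀ s, ∑ t, M.cosineMatrix (f s) (f t) ≤ ∑ t, g s t := fun s ↦
    Finset.sum_le_sum fun t _ ↦ hle s t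
  have hzero : ∑ s, ∑ t, M.cosineMatrix (f s) (f t) = ∑ s, ∑ t, g s t := by
    refine le_antisymm (Finset.sum_le_sum fun s _ ↦ hle' s) ?_
    rw [hgtot, ← hsum]
    exact hM.nonneg x
  have heq : ∀ s t, M.cosineMatrix (f s) (f t) = g s t := by
    intro s t
    have h1 := (Finset.sum_eq_sum_iff_of_le fun s _ ↦ hle' s).1 hzero s (Finset.mem_univ s)
    exact (Finset.sum_eq_sum_iff_of_le fun t _ ↦ hle s t).1 h1 t (Finset.mem_univ t)
  have hsurj : Function.Surjective f := by
    obtain ⟨δ, hδ, hker⟩ := hM.exists_ker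
    obtain ⟨a, ha⟩ := hker x (by rw [hsum, hzero, hgtot])
    have hxf : x (f 0) = 1 := by simp [x]
    intro i
    by_contra hi
    have hxi : x i = 0 := if_neg hi
    have ha0 : a = 0 := by
      rw [ha i] at hxi
      exact (mul_eq_zero.1 hxi).resolve_right (hδ i).ne'
    rw [ha, ha0, zero_mul] at hxf
    exact zero_ne_one hxf
  refine ⟨(Equiv.ofBijective f ⟨hf, hsurj⟩).symm, fun i j ↦ ?_⟩
  obtain ⟨s, rfl⟩ := hsurj i
  obtain ⟨t, rfl⟩ := hsurj j
  have hE : ∀ s, (Equiv.ofBijective f ⟨hf, hsurj⟩).symm (f s) = s :=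
    Equiv.ofBijective_symm_apply_apply f ⟨hf, hsurj⟩
  rw [hE, hE]
  have hst := heq s t
  have h0 := hM.label_ne_zero (f s) (f t)
  by_cases h1 : s = t
  · rw [if_pos h1, h1, M.diagonal]
  rw [if_neg h1, if_neg (by omega)]
  by_cases h2 : t = s + 1 ∨ s = t + 1
  · rw [if_pos h2]
    rw [hg2 s t h2, cosineMatrix, neg_inj] at hst
    refine Real.cos_pi_div_natCast_inj h0 (by norm_num) ?_
    rw [hst, ← Real.cos_pi_div_three]; norm_num
  · rw [if_neg h2]
    rw [hg3 s t (fun h ↦ h1 h.symm) h2, cosineMatrix, neg_eq_zero] at hst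
    refine Real.cos_pi_div_natCast_inj h0 (by norm_num) ?_
    rw [hst, ← Real.cos_pi_div_two]; norm_num

end CoxeterMatrix

/-! ### Realizations of affine Weyl groups -/

namespace CoxeterSystem.Realization

variable {B W : Type*} [Group W] {M : CoxeterMatrix B} {cs : CoxeterSystem M W}
  {V Vd : Type*} [AddCommGroup V] [Module ℝ V] [AddCommGroup Vd] [Module ℝ Vd]

lemma exists_isNormalizedBy_of_isAcyclic [Finite B] (D : cs.Realization V Vd)
    (hM : ∀ i j, M i j ≠ 0) (hG : M.coxeterGraph.IsAcyclic) : ∃ k, D.IsNormalizedBy k := by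
  have hcos : ∀ {i j}, M.coxeterGraph.Adj i j → 0 < Real.cos (Real.pi / M i j) := fun h ↦ by
    have := M.cosineMatrix_le_of_adj h (hM _ _)
    rw [CoxeterMatrix.cosineMatrix] at this
    linarith
  have hprod : ∀ {i j}, M.coxeterGraph.Adj i j →
      D.pairing (D.root i) (D.coroot j) * D.pairing (D.root j) (D.coroot i) =
        4 * Real.cos (Real.pi / M i j) ^ 2 := fun h ↦ D.pairing_mul_pairing_eq h.1 (hM _ _)
  obtain ⟨k, hk, hkr⟩ := hG.exists_potential
    (fun i j ↦ -D.pairing (D.root i) (D.coroot j) / (2 * Real.cos (Real.pi / M i j)))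
    (fun i j h ↦ by
      refine div_pos ?_ (mul_pos two_pos (hcos h))
      have h1 := D.pairing_nonpos i j h.1
      have h2 : D.pairing (D.root i) (D.coroot j) ≠ 0 := fun h0 ↦ by
        have h3 := hprod h
        rw [h0, zero_mul] at h3
        have := hcos h
        exact (by positivity : 4 * Real.cos (Real.pi / M i j) ^ 2 ≠ 0) h3.symm
      exact neg_pos.2 (lt_of_le_of_ne h1 h2))
    (fun i j h ↦ by
      have := (hcos h).ne'
      rw [M.symmetric j i, div_mul_div_comm, neg_mul_neg, hprod h]
      field_simp
      norm_num)
  refine ⟨k, hk, fun i j ↦ ?_⟩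
  rcases eq_or_ne i j with rfl | hij
  · rw [D.pairing_self, M.diagonal]
    simp
  by_cases h2 : M i j = 2
  · have h : D.pairing (D.root i) (D.coroot j) * D.pairing (D.root j) (D.coroot i) = 0 := by
      rw [D.pairing_mul_pairing_eq hij (hM i j), h2]
      simp
    rw [h2]
    have h0 : D.pairing (D.root i) (D.coroot j) = 0 := by
      rcases mul_eq_zero.1 h with h | h
      · exact h
      · exact (D.pairing_eq_zero_iff i j hij).2 h
    rw [h0]
    simp
  · have hadj : M.coxeterGraph.Adj i j := ⟨hij, h2⟩
    have := (hcos hadj).ne'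
    rw [hkr i j hadj]
    field_simp

/-- A linear relation between the simple roots gives a kernel vector of the Cartan matrix. In affine
type the nonzero ones have all entries of the same sign, against positive independence. -/
lemma IsNormalizedBy.linearIndependent_of_isAffine [Fintype B] {D : cs.Realization V Vd}
    {k : B → ℝ} (h : D.IsNormalizedBy k) (hM : M.IsAffine) : LinearIndependent ℝ D.root := by
  rw [Fintype.linearIndependent_iff]
  intro c hc
  have hker : ∀ j, ∑ i, c i / k i * M.cosineMatrix i j = 0 := by
    intro j
    have h1 := congrArg (fun v ↦ D.pairing v (D.coroot j)) hc
    simp only [map_sum, LinearMap.sum_apply, map_smul, LinearMap.smul_apply, smul_eq_mul,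
      map_zero, LinearMap.zero_apply] at h1
    have h2 : ∑ i, c i * D.pairing (D.root i) (D.coroot j) =
        (2 * k j) * ∑ i, c i / k i * M.cosineMatrix i j := by
      rw [Finset.mul_sum]
      refine Finset.sum_congr rfl fun i _ ↦ ?_
      have hki := (h.pos i).ne'
      have h3 := h.pairing_mul i j
      rw [CoxeterMatrix.cosineMatrix]
      field_simp
      linear_combination c i * h3
    rw [h2] at h1
    exact (mul_eq_zero.1 h1).resolve_left (mul_pos two_pos (h.pos j)).ne'
  obtain ⟨δ, hδ, hδker⟩ := hM.exists_ker
  obtain ⟨a, ha⟩ := hδker (fun i ↦ c i / k i) (by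
    rw [Finset.sum_comm]
    refine Finset.sum_eq_zero fun j _ ↦ ?_
    have : ∑ i, c i / k i * (c j / k j) * M.cosineMatrix i j =
        c j / k j * ∑ i, c i / k i * M.cosineMatrix i j := by
      rw [Finset.mul_sum]
      exact Finset.sum_congr rfl fun i _ ↦ by ring
    rw [this, hker, mul_zero])
  have hca : ∀ i, c i = a * (δ i * k i) := by
    intro i
    have h1 := ha i
    rw [div_eq_iff (h.pos i).ne'] at h1
    rw [h1]; ring
  rcases eq_or_ne a 0 with h0 | h0
  · intro i
    rw [hca, h0, zero_mul]
  · intro i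
    refine absurd ?_ (D.root_posIndep Finset.univ (fun i ↦ δ i * k i) ⟨i, Finset.mem_univ i⟩
      (fun i _ ↦ mul_pos (hδ i) (h.pos i)))
    refine (smul_eq_zero.1 (?_ : a • _ = (0 : V))).resolve_left h0
    rw [← hc, Finset.smul_sum]
    exact Finset.sum_congr rfl fun i _ ↦ by rw [smul_smul, hca]

end CoxeterSystem.Realization

/-! ### Affine Weyl groups -/

namespace RootPairing

variable {ι E F : Type*} [AddCommGroup E] [Module ℝ E] [AddCommGroup F] [Module ℝ F]
  (P : RootPairing ι ℝ E F)

lemma affineReflection_apply (a : ι) (k : ℤ) (x : F) :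
    P.affineReflection a k x = P.coreflection a x + (k : ℝ) • P.coroot a := by
  rw [add_comm]; rfl

lemma linearHom_affineReflection (a : ι) (k : ℤ) :
    AffineEquiv.linearHom (P.affineReflection a k) = P.coreflection a := by
  ext x
  rfl

/-- The order of a product of two reflections, read off from the Coxeter weight. The sign `ε` allows
one of the two roots to be replaced by its negative, which does not change its reflection, so that
both pairings become nonpositive. -/
lemma orderOf_coreflection_mul {a b : ι} {m : ℕ} (hm : 2 ≤ m) {ε : ℝ} (hε : ε * ε = 1)
    (hab : ε * P.pairing a b ≤ 0) (hba : ε * P.pairing b a ≤ 0)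
    (h : P.coxeterWeight a b = 4 * Real.cos (Real.pi / m) ^ 2) :
    orderOf (P.coreflection a * P.coreflection b) = m := by
  have hε0 : ε ≠ 0 := by
    rintro rfl
    norm_num at hε
  have hinv : ε⁻¹ = ε := inv_eq_of_mul_eq_one_left hε
  have hg' : (ε⁻¹ • P.root' b) (ε • P.coroot b) = 2 := by
    simp [hε0]
  have key := Module.orderOf_reflection_mul_reflection (f := P.root' a) (g := ε⁻¹ • P.root' b)
    (x := P.coroot a) (y := ε • P.coroot b) hm (P.root_coroot_two a) hg'
    (by simpa using hab) (by simpa [hinv] using hba)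
    (by simpa [hε0] using P.pairing_eq_zero_iff' (i := a) (j := b))
    (by
      rw [← h, coxeterWeight]
      simp only [map_smul, LinearMap.smul_apply, smul_eq_mul, root'_coroot_eq_pairing]
      field_simp)
  rwa [Module.reflection_smul_inv_smul hε0 (P.root_coroot_two b) hg'] at key

/-- Two reflecting hyperplanes that are not parallel meet, so the product of the two affine
reflections has the same order as its linear part. -/
lemma orderOf_affineReflection_mul {a b : ι} (k l : ℤ) (h : P.coxeterWeight a b ≠ 4) :
    orderOf (P.affineReflection a k * P.affineReflection b l) =
      orderOf (P.coreflection a * P.coreflection b) := by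
  have hlin : AffineEquiv.linearHom (P.affineReflection a k * P.affineReflection b l) =
      P.coreflection a * P.coreflection b := by
    rw [map_mul, linearHom_affineReflection, linearHom_affineReflection]
  apply Nat.dvd_antisymm
  · apply orderOf_dvd_of_pow_eq_one
    set n := orderOf (P.coreflection a * P.coreflection b) with hn
    have hd : 4 - P.pairing a b * P.pairing b a ≠ 0 := fun h0 ↦ h (by
      rw [coxeterWeight]; linarith)
    set d := 4 - P.pairing a b * P.pairing b a with hdd
    set p : F := ((2 * k - P.pairing a b * l) / d) • P.coroot a +
      ((2 * l - P.pairing b a * k) / d) • P.coroot b with hp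
    have hpa : P.root' a p = k := by
      simp only [hp, map_add, map_smul, smul_eq_mul, root'_coroot_eq_pairing, pairing_same]
      field_simp
      rw [hdd]; ring
    have hpb : P.root' b p = l := by
      simp only [hp, map_add, map_smul, smul_eq_mul, root'_coroot_eq_pairing, pairing_same]
      field_simp
      rw [hdd]; ring
    have hfix1 : (P.affineReflection a k * P.affineReflection b l) p = p := by
      have hA : ∀ (c : ι) (j : ℤ), P.root' c p = j → P.affineReflection c j p = p := fun c j hc ↦ by
        rw [affineReflection_apply, coreflection_apply, hc, sub_add_cancel]
      rw [AffineEquiv.mul_def, AffineEquiv.trans_apply, hA b l hpb, hA a k hpa]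
    have hfix : ∀ j : ℕ, ((P.affineReflection a k * P.affineReflection b l) ^ j) p = p := by
      intro j
      induction j with
      | zero => rfl
      | succ j ih =>
        rw [pow_succ, AffineEquiv.mul_def, AffineEquiv.trans_apply, hfix1, ih]
    have hl1 : AffineEquiv.linearHom
        ((P.affineReflection a k * P.affineReflection b l) ^ n) = 1 := by
      rw [map_pow, hlin, hn, pow_orderOf_eq_one]
    ext x
    have h1 := ((P.affineReflection a k * P.affineReflection b l) ^ n).map_vadd p (x -ᵥ p)
    rw [vsub_vadd, hfix] at h1
    rw [h1]
    change AffineEquiv.linearHom ((P.affineReflection a k * P.affineReflection b l) ^ n) (x -ᵥ p)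
      +ᵥ p = x
    rw [hl1]
    simp
  · rw [← hlin]
    exact orderOf_map_dvd _ _

/-- The reflections in two distinct parallel hyperplanes generate an infinite group. -/
lemma affineReflection_one_mul_zero_pow_ne_one (a : ι) {n : ℕ} (hn : n ≠ 0) :
    (P.affineReflection a 1 * P.affineReflection a 0) ^ n ≠ 1 := by
  intro h
  have hstep : ∀ x, (P.affineReflection a 1 * P.affineReflection a 0) x = x + P.coroot a := by
    intro x
    rw [AffineEquiv.mul_def, AffineEquiv.trans_apply, affineReflection_apply,
      affineReflection_apply]
    simp
  have hpow : ∀ j : ℕ, ((P.affineReflection a 1 * P.affineReflection a 0) ^ j) 0 =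
      (j : ℝ) • P.coroot a := by
    intro j
    induction j with
    | zero => rw [pow_zero]; simp
    | succ j ih =>
      rw [pow_succ', AffineEquiv.mul_def, AffineEquiv.trans_apply, ih, hstep]
      push_cast
      module
  have h0 := hpow n
  rw [h] at h0
  have h1 : (n : ℝ) • P.coroot a = 0 := h0.symm
  have h2 := congrArg (P.root' a) h1
  simp at h2
  exact hn h2

/-- In a crystallographic root system the values `0, 1, 2, 3` of the Coxeter weight are those of
`4 cos²(π / m)` for `m = 2, 3, 4, 6`. -/
lemma exists_coxeterWeight_eq [Finite ι] [P.IsCrystallographic] {a b : ι}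
    (h : P.coxeterWeight a b ≠ 4) :
    ∃ m : ℕ, 2 ≤ m ∧ P.coxeterWeight a b = 4 * Real.cos (Real.pi / m) ^ 2 := by
  have h1 := P.coxeterWeightIn_mem_set_of_isCrystallographic a b
  rw [← P.algebraMap_coxeterWeightIn ℤ] at h ⊢
  simp only [Set.mem_insert_iff, Set.mem_singleton_iff] at h1
  rcases h1 with h1 | h1 | h1 | h1 | h1 <;> rw [h1] at h ⊢
  · exact ⟨2, by norm_num, by simp⟩
  · exact ⟨3, by norm_num, by norm_num [Real.cos_pi_div_three]⟩
  · exact ⟨4, by norm_num, by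
      norm_num [Real.cos_pi_div_four, div_pow]⟩
  · exact ⟨6, by norm_num, by
      norm_num [Real.cos_pi_div_six, div_pow]⟩
  · exact absurd (by simp) h

namespace Base

variable {P} (b : P.Base) (θ : ι)

lemma exists_nat_of_mem_closure {x : E} (hx : x ∈ AddSubmonoid.closure (P.root '' b.support)) :
    ∃ c : b.support → ℕ, ∑ i, (c i : ℝ) • P.root i = x := by
  rw [← Submodule.span_nat_eq_addSubmonoidClosure, Submodule.mem_toAddSubmonoid,
    Fintype.mem_span_image_iff_exists_fun] at hx
  obtain ⟨c, hc⟩ := hx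
  exact ⟨c, by rw [← hc]; exact Finset.sum_congr rfl fun i _ ↦ Nat.cast_smul_eq_nsmul ℝ _ _⟩

lemma eq_of_sum_smul_root_eq {c d : b.support → ℝ}
    (h : ∑ i, c i • P.root i = ∑ i, d i • P.root i) (i : b.support) : c i = d i :=
  Fintype.linearIndependent_iffₛ.1 b.linearIndepOn_root c d h i

lemma sum_single_smul_root [DecidableEq b.support] (a : b.support) (t : ℝ) :
    ∑ i, (Pi.single a t : b.support → ℝ) i • P.root i = t • P.root a := by
  rw [Finset.sum_eq_single a]
  · simp
  · intro i _ hi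
    simp [hi]
  · simp

/-- Each simple root occurs in the highest root. -/
lemma IsHighest.exists_coeff {b : P.Base} {θ : ι} (h : b.IsHighest θ) :
    ∃ m : b.support → ℝ, (∀ i, 1 ≤ m i) ∧ ∑ i, m i • P.root i = P.root θ := by
  classical
  have hrep : ∀ a : b.support, ∃ c : b.support → ℝ, 1 ≤ c a ∧
      ∑ i, c i • P.root i = P.root θ := by
    intro a
    obtain ⟨c, hc⟩ := b.exists_nat_of_mem_closure (h a)
    refine ⟨fun i ↦ c i + (Pi.single a 1 : b.support → ℝ) i, by simp, ?_⟩
    simp only [add_smul, Finset.sum_add_distrib]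
    rw [hc, b.sum_single_smul_root]
    simp
  have : Nonempty ι := ⟨θ⟩
  obtain ⟨a, ha⟩ := b.support_nonempty
  obtain ⟨m, -, hm⟩ := hrep ⟨a, ha⟩
  refine ⟨m, fun i ↦ ?_, hm⟩
  obtain ⟨c, hc, hc'⟩ := hrep i
  rwa [b.eq_of_sum_smul_root_eq (hm.trans hc'.symm) i]

lemma IsHighest.pairing_nonneg {b : P.Base} {θ : ι} (h : b.IsHighest θ) (a : b.support) :
    0 ≤ P.pairing θ a := by
  classical
  have h1 := h (P.reflectionPerm a θ)
  rw [root_reflectionPerm, reflection_apply_root, sub_sub_cancel] at h1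
  obtain ⟨c, hc⟩ := b.exists_nat_of_mem_closure h1
  rw [← b.sum_single_smul_root] at hc
  have := b.eq_of_sum_smul_root_eq hc a
  rw [Pi.single_eq_same] at this
  rw [← this]
  positivity

/-- The index of the root defining the hyperplane of an affine simple reflection. -/
def affineIndex : Option b.support → ι
  | none => θ
  | some a => a

/-- The sign for which the signed roots point into the fundamental alcove. -/
def affineSign : Option b.support → ℝ
  | none => -1
  | some _ => 1

/-- The inner normals of the walls of the fundamental alcove: the simple roots, and the negative of
the highest root. -/
def affineNormal (o : Option b.support) : E := b.affineSign o • P.root (b.affineIndex θ o)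

lemma affineSign_mul_self (o : Option b.support) : b.affineSign o * b.affineSign o = 1 := by
  cases o <;> simp [affineSign]

lemma affineSimple_eq (o : Option b.support) :
    ∃ k, b.affineSimple θ o = P.affineReflection (b.affineIndex θ o) k := by
  cases o
  · exact ⟨1, rfl⟩
  · exact ⟨0, rfl⟩

variable [Fintype ι]

lemma rootForm_root_pos (a : ι) : 0 < P.RootForm (P.root a) (P.root a) :=
  P.rootForm_pos_of_ne_zero (Submodule.subset_span (Set.mem_range_self a)) (P.ne_zero a)

lemma two_mul_rootForm (a c : ι) :
    2 * P.RootForm (P.root a) (P.root c) =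
      P.pairing a c * P.RootForm (P.root c) (P.root c) :=
  (P.posRootForm ℝ).two_mul_apply_root_root a c

lemma rootForm_comm (x y : E) : P.RootForm x y = P.RootForm y x := P.rootForm_symmetric.eq x y

/-- The inner normals of the alcove make pairwise non-acute angles. -/
lemma IsHighest.rootForm_affineNormal_nonpos [P.IsCrystallographic] {b : P.Base} {θ : ι}
    (h : b.IsHighest θ) {o o' : Option b.support} (hne : o ≠ o') :
    P.RootForm (b.affineNormal θ o) (b.affineNormal θ o') ≤ 0 := by
  have hθ : ∀ a : b.support, 0 ≤ P.RootForm (P.root θ) (P.root a) := fun a ↦ by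
    have h1 := two_mul_rootForm (P := P) θ a
    have h2 := mul_nonneg (h.pairing_nonneg a) (rootForm_root_pos (P := P) a).le
    linarith
  match o, o' with
  | none, none => exact absurd rfl hne
  | none, some a => simpa [affineNormal, affineSign, affineIndex] using hθ a
  | some a, none =>
    rw [rootForm_comm]
    simpa [affineNormal, affineSign, affineIndex] using hθ a
  | some a, some a' =>
    have hne' : (a : ι) ≠ a' := fun h ↦ hne (congrArg some (Subtype.ext h))
    have h0 : P.pairing a a' ≤ 0 := by
      rw [← P.algebraMap_pairingIn ℤ, eq_intCast]
      exact_mod_cast b.pairingIn_le_zero_of_ne hne' a.2 a'.2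
    have h1 := two_mul_rootForm (P := P) a a'
    have h2 := mul_nonpos_of_nonpos_of_nonneg h0 (rootForm_root_pos (P := P) a').le
    simp only [affineNormal, affineSign, affineIndex, one_smul]
    linarith

lemma rootForm_affineNormal (o o' : Option b.support) :
    P.RootForm (b.affineNormal θ o) (b.affineNormal θ o') =
      b.affineSign o * b.affineSign o' *
        P.RootForm (P.root (b.affineIndex θ o)) (P.root (b.affineIndex θ o')) := by
  simp only [affineNormal, map_smul, LinearMap.smul_apply, smul_eq_mul]
  ring

lemma rootForm_affineNormal_self (o : Option b.support) :
    P.RootForm (b.affineNormal θ o) (b.affineNormal θ o) =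
      P.RootForm (P.root (b.affineIndex θ o)) (P.root (b.affineIndex θ o)) := by
  rw [rootForm_affineNormal, affineSign_mul_self, one_mul]

lemma IsHighest.sign_mul_pairing_nonpos [P.IsCrystallographic] {b : P.Base} {θ : ι}
    (h : b.IsHighest θ) {o o' : Option b.support} (hne : o ≠ o') :
    b.affineSign o * b.affineSign o' *
      P.pairing (b.affineIndex θ o) (b.affineIndex θ o') ≤ 0 := by
  have h1 := h.rootForm_affineNormal_nonpos hne
  rw [rootForm_affineNormal] at h1
  have h2 := two_mul_rootForm (P := P) (b.affineIndex θ o) (b.affineIndex θ o')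
  have h3 := rootForm_root_pos (P := P) (b.affineIndex θ o')
  by_contra hcon
  have h4 := mul_pos (not_le.1 hcon) h3
  rw [mul_assoc, ← h2] at h4
  linarith

/-- Two walls of the alcove are parallel only in rank one. -/
lemma IsHighest.subsingleton_support_of_coxeterWeight [P.IsReduced] {b : P.Base}
    {θ : ι} (h : b.IsHighest θ) {o o' : Option b.support} (hne : o ≠ o')
    (h4 : P.coxeterWeight (b.affineIndex θ o) (b.affineIndex θ o') = 4) :
    Subsingleton b.support ∧ ∀ a : b.support, (a : ι) = θ := by
  classical
  have key : ∀ a : b.support, P.coxeterWeight θ a = 4 →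
      Subsingleton b.support ∧ ∀ a : b.support, (a : ι) = θ := by
    intro a ha
    have hdep : ¬ LinearIndependent ℝ ![P.root θ, P.root a] := by
      rw [P.linearIndependent_iff_coxeterWeight_ne_four, not_not, ha]
    obtain ⟨m, hm, hsum⟩ := h.exists_coeff
    have hcoef : ∃ t : ℝ, P.root θ = t • P.root a := by
      rcases IsReduced.eq_or_eq_neg (P := P) θ a hdep with h1 | h1
      · exact ⟨1, by rw [one_smul, h1]⟩
      · exact ⟨-1, by rw [h1, neg_one_smul]⟩
    obtain ⟨t, ht⟩ := hcoef
    rw [ht, ← b.sum_single_smul_root] at hsum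
    have hm' := b.eq_of_sum_smul_root_eq hsum
    have hall : ∀ a' : b.support, a' = a := by
      intro a'
      by_contra hne
      have := hm a'
      rw [hm', Pi.single_eq_of_ne hne] at this
      linarith
    refine ⟨⟨fun x y ↦ (hall x).trans (hall y).symm⟩, fun a' ↦ ?_⟩
    rw [hall a']
    rcases IsReduced.eq_or_eq_neg (P := P) θ a hdep with h1 | h1
    · exact P.root.injective h1.symm
    · exfalso
      have h2 : t • P.root a = (-1 : ℝ) • P.root a := by rw [← ht, h1, neg_one_smul]
      have h3 := smul_left_injective ℝ (P.ne_zero a) h2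
      have h4 := hm a
      rw [hm', Pi.single_eq_same, h3] at h4
      linarith
  match o, o' with
  | none, none => exact absurd rfl hne
  | none, some a => exact key a h4
  | some a, none => exact key a (by rw [coxeterWeight_swap]; exact h4)
  | some a, some a' =>
    exact absurd h4 ((P.linearIndependent_iff_coxeterWeight_ne_four).1
      (b.linearIndependent_pair_of_ne fun h ↦ hne (congrArg some h)))

end Base

end RootPairing

namespace CoxeterSystem

open RootPairing

variable {B W : Type*} [Group W] {M : CoxeterMatrix B}

/-- The Coxeter matrix of an irreducible affine Weyl group other than that of type `Ã₁` is affine: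
the entries `-cos(π / m_ij)` are the inner products of the unit inner normals of the fundamental
alcove, and the highest root gives the linear relation between these. -/
theorem IsIrreducibleAffineWeyl.exists_isAffine {cs : CoxeterSystem M W}
    (h : cs.IsIrreducibleAffineWeyl) (hA : ¬ M.IsTypeATilde) :
    ∃ _ : Fintype B, M.IsAffine := by
  classical
  obtain ⟨ι, E, F, _, _, _, _, _, P, _, _, _, _, b, θ, hθ, e, f, hf⟩ := h
  have := Fintype.ofFinite ι
  have : Fintype B := Fintype.ofEquiv _ e.symm
  refine ⟨this, ?_⟩
  set idx : B → ι := fun i ↦ b.affineIndex θ (e i) with hidx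
  have hord : ∀ i j, M i j =
      orderOf (b.affineSimple θ (e i) * b.affineSimple θ (e j)) := by
    intro i j
    rw [← cs.orderOf_simple_mul_simple, ← hf, ← hf, ← Subgroup.coe_mul, ← map_mul,
      Subgroup.orderOf_coe]
    exact (orderOf_injective f.toMonoidHom f.injective _).symm
  -- Parallel walls occur only in type `Ã₁`.
  have hw : ∀ i j, i ≠ j → P.coxeterWeight (idx i) (idx j) ≠ 4 := by
    intro i j hij h4
    obtain ⟨hsub, hall⟩ :=
      hθ.subsingleton_support_of_coxeterWeight (fun h ↦ hij (e.injective h)) h4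
    have hzero : ∀ i j, e i = none → e j ≠ none → M i j = 0 := by
      intro i j hi hj
      obtain ⟨a, ha⟩ := Option.ne_none_iff_exists'.1 hj
      by_contra h0
      refine P.affineReflection_one_mul_zero_pow_ne_one θ h0 ?_
      have h1 : b.affineSimple θ (e i) * b.affineSimple θ (e j) =
          P.affineReflection θ 1 * P.affineReflection θ 0 := by
        rw [hi, ha]
        change P.affineReflection θ 1 * P.affineReflection (a : ι) 0 = _
        rw [hall]
      rw [← h1, hord, pow_orderOf_eq_one]
    refine hA ⟨1, le_rfl, e.trans ((Equiv.ofBijective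
      (fun o : Option b.support ↦ if o = none then (0 : ZMod 2) else 1) ⟨?_, ?_⟩)), ?_⟩
    · rintro (_ | a) (_ | a') h
      · rfl
      · simp at h
      · simp at h
      · rw [Subsingleton.elim a a']
    · intro z
      have : Nonempty ι := ⟨θ⟩
      obtain ⟨a, ha⟩ := b.support_nonempty
      fin_cases z
      · exact ⟨none, if_pos rfl⟩
      · exact ⟨some ⟨a, ha⟩, if_neg (by simp)⟩
    · intro i' j'
      simp only [Equiv.apply_eq_iff_eq]
      split_ifs with h1
      · rw [h1, M.diagonal]
      · by_cases hi : e i' = none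
        · exact hzero i' j' hi fun hj ↦ h1 (e.injective (hi.trans hj.symm))
        · rw [M.symmetric]
          refine hzero j' i' ?_ hi
          by_contra hj
          obtain ⟨a, ha⟩ := Option.ne_none_iff_exists'.1 hi
          obtain ⟨a', ha'⟩ := Option.ne_none_iff_exists'.1 hj
          exact h1 (e.injective (by rw [ha, ha', Subsingleton.elim a a']))
  have hlabel : ∀ i j, i ≠ j → 2 ≤ M i j ∧
      P.coxeterWeight (idx i) (idx j) = 4 * Real.cos (Real.pi / M i j) ^ 2 := by
    intro i j hij
    obtain ⟨m, hm, hm'⟩ := P.exists_coxeterWeight_eq (hw i j hij)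
    have hne : e i ≠ e j := fun h ↦ hij (e.injective h)
    obtain ⟨k, hk⟩ := b.affineSimple_eq θ (e i)
    obtain ⟨l, hl⟩ := b.affineSimple_eq θ (e j)
    have h1 : M i j = m := by
      rw [hord, hk, hl, P.orderOf_affineReflection_mul k l (hw i j hij)]
      refine P.orderOf_coreflection_mul hm
        (ε := b.affineSign (e i) * b.affineSign (e j)) ?_
        (hθ.sign_mul_pairing_nonpos hne) ?_ hm'
      · rw [mul_mul_mul_comm, b.affineSign_mul_self, b.affineSign_mul_self, one_mul]
      · rw [mul_comm (b.affineSign (e i))]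
        exact hθ.sign_mul_pairing_nonpos hne.symm
    rw [h1]
    exact ⟨hm, hm'⟩
  set γ : B → E := fun i ↦ b.affineNormal θ (e i) with hγ
  have hself : ∀ i, P.RootForm (γ i) (γ i) =
      P.RootForm (P.root (idx i)) (P.root (idx i)) := fun i ↦ b.rootForm_affineNormal_self θ (e i)
  have hpos : ∀ i, 0 < P.RootForm (γ i) (γ i) := fun i ↦ by
    rw [hself]
    exact Base.rootForm_root_pos _
  set len : B → ℝ := fun i ↦ √(P.RootForm (γ i) (γ i)) with hlen
  have hlpos : ∀ i, 0 < len i := fun i ↦ Real.sqrt_pos.2 (hpos i)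
  have hlsq : ∀ i, len i ^ 2 = P.RootForm (γ i) (γ i) := fun i ↦ Real.sq_sqrt (hpos i).le
  have hgram : ∀ i j, P.RootForm (γ i) (γ j) = len i * len j * M.cosineMatrix i j := by
    intro i j
    rcases eq_or_ne i j with rfl | hij
    · rw [M.cosineMatrix_self, ← hlsq]; ring
    have hne : e i ≠ e j := fun h ↦ hij (e.injective h)
    obtain ⟨h2, hw'⟩ := hlabel i j hij
    have h1 := Base.two_mul_rootForm (P := P) (idx i) (idx j)
    have h1' := Base.two_mul_rootForm (P := P) (idx j) (idx i)
    have hq : P.RootForm (γ i) (γ j) = b.affineSign (e i) * b.affineSign (e j) *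
      P.RootForm (P.root (idx i)) (P.root (idx j)) := b.rootForm_affineNormal θ (e i) (e j)
    have hss : (b.affineSign (e i) * b.affineSign (e j)) *
        (b.affineSign (e i) * b.affineSign (e j)) = 1 := by
      rw [mul_mul_mul_comm, b.affineSign_mul_self, b.affineSign_mul_self, one_mul]
    have key := eq_neg_mul_of_pairing_mul_pairing
      (a := b.affineSign (e i) * b.affineSign (e j) * P.pairing (idx i) (idx j))
      (a' := b.affineSign (e i) * b.affineSign (e j) * P.pairing (idx j) (idx i))
      (q := P.RootForm (γ i) (γ j)) (n := len i) (n' := len j)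
      (c := Real.cos (Real.pi / M i j))
      (by rw [hlsq, hself, mul_assoc, ← h1, hq]; ring)
      (by rw [hlsq, hself, mul_assoc, ← h1', hq, Base.rootForm_comm (P.root (idx j))]; ring)
      (by rw [mul_mul_mul_comm, hss, one_mul, ← hw']; rfl)
      (hθ.rootForm_affineNormal_nonpos hne) (Real.cos_pi_div_natCast_nonneg h2) (hlpos i) (hlpos j)
    rw [key, CoxeterMatrix.cosineMatrix]; ring
  have hform : ∀ x : B → ℝ, ∑ i, ∑ j, x i * x j * M.cosineMatrix i j =
      P.RootForm (∑ i, (x i / len i) • γ i) (∑ i, (x i / len i) • γ i) := by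
    intro x
    simp only [map_sum, LinearMap.sum_apply, map_smul, LinearMap.smul_apply, smul_eq_mul,
      Finset.mul_sum]
    rw [Finset.sum_comm]
    refine Finset.sum_congr rfl fun i _ ↦ Finset.sum_congr rfl fun j _ ↦ ?_
    have hi := (hlpos i).ne'
    have hj := (hlpos j).ne'
    rw [hgram]
    field_simp
  obtain ⟨m, hm, hsum⟩ := hθ.exists_coeff
  refine ⟨fun i j ↦ ?_, fun x ↦ ?_, ?_⟩
  · rcases eq_or_ne i j with rfl | hij
    · rw [M.diagonal]; exact one_ne_zero
    · have := (hlabel i j hij).1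
      omega
  · rw [hform]
    exact P.zero_le_rootForm _
  · refine ⟨fun i ↦ len i * (e i).elim 1 m, fun i ↦ mul_pos (hlpos i) ?_, fun x hx ↦ ?_⟩
    · cases e i with
      | none => exact one_pos
      | some a => exact lt_of_lt_of_le one_pos (hm a)
    · rw [hform] at hx
      have hv : ∑ i, (x i / len i) • γ i = 0 := P.eq_zero_of_mem_rootSpan_of_rootForm_self_eq_zero
        (Submodule.sum_mem _ fun i _ ↦ Submodule.smul_mem _ _ (Submodule.smul_mem _ _
          (Submodule.subset_span (Set.mem_range_self _)))) hx
      set y : Option b.support → ℝ := fun o ↦ x (e.symm o) / len (e.symm o) with hy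
      have hv' : ∑ o, y o • b.affineNormal θ o = 0 := by
        rw [← hv]
        exact (Fintype.sum_equiv e _ _ fun i ↦ by simp [hy, γ]).symm
      rw [Fintype.sum_option] at hv'
      have hcoef : ∀ a, y (some a) = y none * m a := by
        refine b.eq_of_sum_smul_root_eq ?_
        simp only [Base.affineNormal, Base.affineSign, Base.affineIndex, one_smul] at hv'
        simp only [mul_smul, ← Finset.smul_sum]
        rw [hsum]
        rw [neg_smul, one_smul, smul_neg] at hv'
        exact (neg_add_eq_zero.1 hv').symm
      refine ⟨y none, fun i ↦ ?_⟩
      have hxi : x i = len i * y (e i) := by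
        have := (hlpos i).ne'
        simp only [hy, Equiv.symm_apply_apply]
        field_simp
      have hcoef' : ∀ o, y o = y none * o.elim 1 m := by
        rintro (_ | a)
        · exact (mul_one _).symm
        · exact hcoef a
      rw [hxi, hcoef' (e i)]
      ring

end CoxeterSystem

theorem mainTheorem6 {B W : Type*} [Group W] {M : CoxeterMatrix B} (cs : CoxeterSystem M W)
    (hW : Finite W ∨ (cs.IsIrreducibleAffineWeyl ∧ ¬ M.IsTypeATilde))
    {V₁ Vd₁ V₂ Vd₂ : Type*}
    [AddCommGroup V₁] [Module ℝ V₁] [AddCommGroup Vd₁] [Module ℝ Vd₁]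
    [AddCommGroup V₂] [Module ℝ V₂] [AddCommGroup Vd₂] [Module ℝ Vd₂]
    (D₁ : cs.Realization V₁ Vd₁) (D₂ : cs.Realization V₂ Vd₂) :
    ∃ O : OrientedMatroid (cs.Reflections × ℤˣ), D₁.Induces O ∧ D₂.Induces O := by
  rcases hW with hfin | ⟨haff, hA⟩
  · obtain ⟨hli₁, k₁, h₁⟩ := D₁.exists_isNormalizedBy_of_finite
    obtain ⟨hli₂, k₂, h₂⟩ := D₂.exists_isNormalizedBy_of_finite
    exact ⟨cs.geometricOrientedMatroid cs.label_ne_zero_of_finite, h₁.induces hli₁ _,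
      h₂.induces hli₂ _⟩
  · obtain ⟨_, hM⟩ := haff.exists_isAffine hA
    have hG := hM.isAcyclic hA
    obtain ⟨k₁, h₁⟩ := D₁.exists_isNormalizedBy_of_isAcyclic hM.label_ne_zero hG
    obtain ⟨k₂, h₂⟩ := D₂.exists_isNormalizedBy_of_isAcyclic hM.label_ne_zero hG
    exact ⟨cs.geometricOrientedMatroid hM.label_ne_zero,
      h₁.induces (h₁.linearIndependent_of_isAffine hM) _,
      h₂.induces (h₂.linearIndependent_of_isAffine hM) _⟩
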